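/- Let $A$ and $B$ be finite classical systems. Densities are probability vectors, $\log$ is the natural logarithm, $D(p\|q)=\sum_i p_i(\log p_i-\log q_i)$, and for a density $\rho$ on $AB$ with marginals $\rho^A,\rho^B$ the mutual information is $I[A:B](\rho)=D(\rho\,\|\,\rho^A\otimes\rho^B)$. Let $\mathcal L$ be a classical Lindbladian on $B$, that is, a linear map such that $\Phi^t=\exp(-t\mathcal L)$ sends densities to densities for every $t\ge 0$, and let $\mathcal E=\lim_{t\to\infty}\Phi^t$ be its fixed point projection. Let $c\in\mathbb R$ be such that $c\,\mathcal E\ge_{cp}\mathrm{Id}$, meaning that $c(\mathcal E\otimes\mathrm{Id})(\eta)\ge\eta$ entrywise for every density $\eta$ on every extension of $B$ by a finite auxiliary system. Let $\|\mathcal L\|_\Diamond$ be the supremum of $\|(\mathcal L\otimes \mathrm{Id})(X)\|_1$ over all finite auxiliary systems and all $X$ with $\|X\|_1=1$, and put, for $t\ge 0$, $$\epsilon=\epsilon_{\mathcal L,t}=1-\exp\bigl(-t\,c\,\|\mathcal L\|_\Diamond/2\bigr).$$ Let $\rho$ be a density on $AB$ with $(\mathrm{Id}^A\otimes\mathcal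 E)(\rho)=\rho^A\otimes\omega$ for a density $\omega$ on $B$. Let $\tilde m$ be the smallest non-zero entry of $(\rho^A\otimes\rho^B)\oplus(\rho^A\otimes\omega)|_{\mathrm{supp}(\rho^A\otimes\rho^B)}$, let $g=\min\{\gamma:\gamma\rho^B\ge P_{\rho^B}(\omega)\}$, where $P_{\rho^B}(\omega)$ is the restriction of $\omega$ to the support of $\rho^B$, and, with $h(\epsilon)=-\epsilon\log\epsilon-(1-\epsilon)\log(1-\epsilon)$, $$f_{\tilde m}(\epsilon)=h(\epsilon)+\epsilon\log\bigl(\epsilon+(1-\epsilon)\tilde m^{-1}\bigr)+(1-\epsilon)\log\bigl((1-\epsilon)+\epsilon\tilde m^{-1}\bigr).$$ Then for every $a\in(0,1)$ with $a\tilde m^2>2f_{\tilde m}(\epsilon)/(1-\epsilon)$, $$I[A:B]\bigl((\mathrm{Id}^A\otimes\Phi^t)(\rho)\bigr)\ \ge\ I[A:B](\rho)\cdot\begin{cases}1-\epsilon-\dfrac{2f_{\tilde m}(\epsilon)}{a\tilde m^2} & \text{if } I[A:B](\rho)\ge a\tilde m^2/2,\\[2ex] \dfrac{(1-a)(1-\epsilon)^2}{(1-\epsilon)(1-a)+\epsilon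 g} & \text{if } I[A:B](\rho)\le a\tilde m^2/2.\end{cases}$$ The constants $\tilde m$, $g$, $\epsilon$ and the two factors depend only on $\rho^A\otimes\rho^B$, $\omega$, $\mathcal L$, $c$, $t$ and $a$, not on the correlated density $\rho$ itself. -/

import Mathlib

open Matrix Filter Topology
open scoped Kronecker

/- A classical system is a finite set `B`; its densities are the probability vectors, that is, the
elements of `stdSimplex ℝ B`, and a linear map on the (real) functions on `B` is a matrix `T` acting
by `T *ᵥ p`. -/

namespace ClassicalDecay

noncomputable section

/-- A classical channel: a linear map that sends densities to densities. -/
def IsChannel {B : Type*} [Fintype B] (T : Matrix B B ℝ) : Prop :=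
  ∀ p ∈ stdSimplex ℝ B, T *ᵥ p ∈ stdSimplex ℝ B

/-- The family `Φ^t = exp (-t L)` generated by `L`. -/
def semigroup {B : Type*} [Fintype B] [DecidableEq B] (L : Matrix B B ℝ) (t : ℝ) : Matrix B B ℝ :=
  NormedSpace.exp (-(t • L))

/-- `L` is a (classical) Lindbladian: `exp (-t L)` is a channel for every `t ≥ 0`. -/
def IsLindbladian {B : Type*} [Fintype B] [DecidableEq B] (L : Matrix B B ℝ) : Prop :=
  ∀ t : ℝ, 0 ≤ t → IsChannel (semigroup L t)

/-- `E` is the projection on the fixed points of the semigroup: `E = lim_{t → ∞} exp (-t L)`. -/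
def IsFixedPointProjection {B : Type*} [Fintype B] [DecidableEq B] (L E : Matrix B B ℝ) : Prop :=
  Tendsto (fun t : ℝ => semigroup L t) atTop (𝓝 E)

/-- The order `S ≤_cp T` of linear maps: `(S ⊗ Id)(ρ) ≤ (T ⊗ Id)(ρ)` for every density `ρ` on
every extension of the system by a finite auxiliary system. -/
def CPLe {B : Type*} [Fintype B] (S T : Matrix B B ℝ) : Prop :=
  ∀ n : ℕ, ∀ r ∈ stdSimplex ℝ (B × Fin n),
    (S ⊗ₖ (1 : Matrix (Fin n) (Fin n) ℝ)) *ᵥ r ≤ (T ⊗ₖ (1 : Matrix (Fin n) (Fin n) ℝ)) *ᵥ r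

/-- The norm `‖x‖₁`. -/
def l1Norm {ι : Type*} [Fintype ι] (x : ι → ℝ) : ℝ := ∑ i, |x i|

/-- The diamond norm: the supremum of `‖(T ⊗ Id)(X)‖₁` over all finite auxiliary systems and all
`X` on the extended system with `‖X‖₁ = 1`. -/
def diamondNorm {B : Type*} [Fintype B] (T : Matrix B B ℝ) : ℝ :=
  sSup {r : ℝ | ∃ n : ℕ, ∃ X : B × Fin n → ℝ, l1Norm X = 1 ∧
    r = l1Norm ((T ⊗ₖ (1 : Matrix (Fin n) (Fin n) ℝ)) *ᵥ X)}

/-- The marginal `ρ^A` of `ρ` on `AB`. -/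
def margA {A B : Type*} [Fintype B] (r : A × B → ℝ) : A → ℝ := fun a => ∑ b, r (a, b)

/-- The marginal `ρ^B` of `ρ` on `AB`. -/
def margB {A B : Type*} [Fintype A] (r : A × B → ℝ) : B → ℝ := fun b => ∑ a, r (a, b)

/-- The product `p ⊗ q`. -/
def prodDensity {A B : Type*} (p : A → ℝ) (q : B → ℝ) : A × B → ℝ := fun x => p x.1 * q x.2

/-- `(Id^A ⊗ T)(ρ)` for a map `T` that acts on `B`. -/
def actB {A B : Type*} [Fintype A] [DecidableEq A] [Fintype B] (T : Matrix B B ℝ)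
    (r : A × B → ℝ) : A × B → ℝ :=
  ((1 : Matrix A A ℝ) ⊗ₖ T) *ᵥ r

/-- The relative entropy `D(p ‖ q) = ∑ p (log p - log q)` (natural logarithm), for densities with
`supp p ⊆ supp q`. -/
def relEntropy {ι : Type*} [Fintype ι] (p q : ι → ℝ) : ℝ :=
  ∑ i, p i * (Real.log (p i) - Real.log (q i))

/-- The mutual information `I[A:B](ρ) = D(ρ ‖ ρ^A ⊗ ρ^B)`. The support of `ρ` is always contained in
that of `ρ^A ⊗ ρ^B`. -/
def mutualInfo {A B : Type*} [Fintype A] [Fintype B] (r : A × B → ℝ) : ℝ :=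
  relEntropy r (prodDensity (margA r) (margB r))

/-- `P_p(w)`: the restriction of `w` to the support of `p`. -/
def suppRestrict {ι : Type*} (p w : ι → ℝ) : ι → ℝ :=
  (Function.support p).indicator w

/-- `ε_{L,t} = 1 - exp (-t c ‖L‖_◇ / 2)`. -/
def noise {B : Type*} [Fintype B] (L : Matrix B B ℝ) (c t : ℝ) : ℝ :=
  1 - Real.exp (-(t * c * diamondNorm L / 2))

/-- The smallest non-zero entry of `(ρ^A ⊗ ρ^B) ⊕ (ρ^A ⊗ ω)|_{supp (ρ^A ⊗ ρ^B)}`, for `ρ^A = p`,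
`ρ^B = q`, `ω = w`. -/
def minEntry {A B : Type*} (p : A → ℝ) (q w : B → ℝ) : ℝ :=
  sInf {v : ℝ | v ≠ 0 ∧ ∃ x : A × B, v = prodDensity p q x ∨
    v = suppRestrict (prodDensity p q) (prodDensity p w) x}

/-- `min {γ | γ ρ^B ≥ P_{ρ^B}(ω)}`, for `ρ^B = q`, `ω = w`. -/
def orderConst {B : Type*} (q w : B → ℝ) : ℝ :=
  sInf {γ : ℝ | suppRestrict q w ≤ γ • q}

/-- `f_m(ε) = h(ε) + ε log (ε + (1 - ε)/m) + (1 - ε) log ((1 - ε) + ε/m)`, with `h` the binary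
entropy. -/
def contFun (m ε : ℝ) : ℝ :=
  Real.binEntropy ε + ε * Real.log (ε + (1 - ε) * m⁻¹)
    + (1 - ε) * Real.log ((1 - ε) + ε * m⁻¹)

end

end ClassicalDecay

/-!
Write `e = 1 - exp (-t ‖L‖_◇ / 2)`. Since `‖L‖_◇ / 2` bounds the jump rates of the generator, the
semigroup at time `t` is `(1 - e) Id + P` with `P ≥ 0` entrywise, column sums `e` and `P E = e E`
(`isMovingPart_semigroup`). The order `Id ≤ c E` enters through `c E b b ≥ 1`; it gives
`c e ≤ ε / (1 - ε)` for the noise `ε`, the bound `P ≤ c e E`, and the structure of `E`: within an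
ergodic class all columns of `E` agree, and a class of `n` states satisfies
`c E b b + n - 1 ≤ c`. Let `m` be the smallest entry; if the mutual information is positive then
both marginals have at least two states, so `m ≤ 1 / 4`, and the condition on `f_m(ε)` forces
`ε ≤ a m ^ 3` (`noise_le_of_contFun_lt`).

*Large mutual information.* The part `(1 - e) ρ` keeps `(1 - e) I`, up to the entropy of mixing and
the growth of the product density, and the moved part has nonnegative relative entropy
(`mul_mutualInfo_sub_le`). The resulting loss is at most `f_m(ε)`.

*Small mutual information.* Put `σ = ρ^A ⊗ ρ^B`, `δ = ρ - σ`. Along `σ + u δ`, `0 ≤ u ≤ 1`, the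
second derivative of the relative entropy to `σ` is the quadratic form `∑ δ ^ 2 / (σ + u δ)`, and so it
suffices to show that the semigroup contracts this form by at most the factor
`(1 - ε) ^ 2 / ((1 - ε) + ε g / (1 - a))` (`mul_relEntropy_le_of_forall`). The form splits over the
states of `A`. On one slice `w` of `σ + u δ`, the loss is at most
`∑ b x, P b x w x (r b - r x) ^ 2` with `r = δ / w`, and the Cauchy–Schwarz inequality
`(r b - r x) ^ 2 ≤ (1 / w b + 1 / w x) (w b (r b) ^ 2 + w x (r x) ^ 2)` makes it diagonal
(`sum_sq_div_sub_le`). The diagonal coefficient at `b` is bounded in terms of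
`G = max (∑ w / w x)`, over the class of `b`:
it is at most `e (min (n, c - n + 2) + G)` for a class of `n ≥ 3` states, and
`e G ^ 2 / (G - 1)` for two states.

If `w = σ` on this slice then `G ≤ c g`. In general `w` falls below `σ` by a factor `1 - z`, and
`σ z ^ 2 ≤ a m ^ 2`, because `x log x - x + 1 ≥ (1 - x) ^ 2 / 2` on `[0, 1]`. For `z ≤ a` the factor
`1 / (1 - a)` in the claim absorbs the change. For small `a` this can fail; then the excess
`z - a` is of order `m`, and it is absorbed by the gap between the coefficient above and
`c + G` (`IsNearSlice.lossCoef_le`). The terms of second order in `ε` are covered by `ε ≤ a m ^ 3`.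
-/

set_option linter.unusedSectionVars false

/-! ### Channels and the exponential of a generator -/

namespace ClassicalDecay

lemma l1Norm_kronecker_one_le {B : Type*} [Fintype B] (T : Matrix B B ℝ) (n : ℕ)
    (X : B × Fin n → ℝ) :
    l1Norm ((T ⊗ₖ (1 : Matrix (Fin n) (Fin n) ℝ)) *ᵥ X) ≤ (∑ i, ∑ j, |T i j|) * l1Norm X := by
  have hrow : ∀ b i, ((T ⊗ₖ (1 : Matrix (Fin n) (Fin n) ℝ)) *ᵥ X) (b, i)
      = ∑ b', T b b' * X (b', i) := by
    intro b i
    simp [Matrix.mulVec, dotProduct, Fintype.sum_prod_type, Matrix.one_apply]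
  unfold l1Norm
  rw [Fintype.sum_prod_type, Fintype.sum_prod_type, Finset.sum_mul]
  refine Finset.sum_le_sum fun b _ => ?_
  calc ∑ i, |((T ⊗ₖ (1 : Matrix (Fin n) (Fin n) ℝ)) *ᵥ X) (b, i)|
      ≤ ∑ i, ∑ b', |T b b'| * |X (b', i)| := by
        refine Finset.sum_le_sum fun i _ => ?_
        rw [hrow]
        refine (Finset.abs_sum_le_sum_abs _ _).trans (le_of_eq ?_)
        simp only [abs_mul]
    _ = ∑ b', |T b b'| * ∑ i, |X (b', i)| := by
        rw [Finset.sum_comm]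
        simp only [Finset.mul_sum]
    _ ≤ ∑ b', |T b b'| * ∑ x, ∑ i, |X (x, i)| := by
        refine Finset.sum_le_sum fun b' _ => mul_le_mul_of_nonneg_left ?_ (abs_nonneg _)
        exact Finset.single_le_sum (f := fun x => ∑ i, |X (x, i)|)
          (fun x _ => Finset.sum_nonneg fun i _ => abs_nonneg _) (Finset.mem_univ b')
    _ = _ := by rw [Finset.sum_mul]

lemma diamondNorm_nonneg {B : Type*} [Fintype B] (T : Matrix B B ℝ) : 0 ≤ diamondNorm T := by
  refine Real.sSup_nonneg ?_
  rintro r ⟨n, X, -, rfl⟩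
  exact Finset.sum_nonneg fun _ _ => abs_nonneg _

section Generator

variable {B : Type*} [Fintype B] [DecidableEq B]

lemma IsChannel.nonneg {T : Matrix B B ℝ} (hT : IsChannel T) (i j : B) : 0 ≤ T i j := by
  have h := (hT _ (single_mem_stdSimplex ℝ j)).1 i
  simpa using h

lemma IsChannel.sum_col {T : Matrix B B ℝ} (hT : IsChannel T) (j : B) : ∑ i, T i j = 1 := by
  have h := (hT _ (single_mem_stdSimplex ℝ j)).2
  simpa using h

/-- The exponential of an entrywise nonnegative matrix dominates the identity entrywise: all terms
of the exponential series are nonnegative, and the term of order zero is the identity. -/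
lemma one_apply_le_exp_apply {M : Matrix B B ℝ} (hM : ∀ i j, 0 ≤ M i j) (i j : B) :
    (1 : Matrix B B ℝ) i j ≤ NormedSpace.exp M i j := by
  open scoped Matrix.Norms.Operator in
  have h := NormedSpace.exp_series_hasSum_exp' (𝕂 := ℝ) M
  have h2 := (Pi.hasSum.1 (Pi.hasSum.1 h i)) j
  have hpow : ∀ n : ℕ, ∀ i j, 0 ≤ (M ^ n) i j := by
    intro n
    induction n with
    | zero => intro i j; rw [pow_zero, Matrix.one_apply]; split_ifs <;> norm_num
    | succ k ih =>
      intro i j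
      rw [pow_succ, Matrix.mul_apply]
      exact Finset.sum_nonneg fun x _ => mul_nonneg (ih _ _) (hM _ _)
  have h3 := h2.summable.le_tsum 0 (fun n _ => ?_)
  · rw [h2.tsum_eq] at h3
    refine le_trans (le_of_eq ?_) h3
    simp
  · exact mul_nonneg (by positivity) (hpow n i j)

lemma semigroup_zero (L : Matrix B B ℝ) : semigroup L 0 = 1 := by
  simp [semigroup, NormedSpace.exp_zero]

lemma semigroup_add (L : Matrix B B ℝ) (s t : ℝ) :
    semigroup L (s + t) = semigroup L s * semigroup L t := by
  unfold semigroup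
  rw [← Matrix.exp_add_of_commute]
  · congr 1
    rw [add_smul, neg_add]
  · exact (((Commute.refl L).smul_left s).smul_right t).neg_left.neg_right

lemma hasDerivAt_semigroup_apply (L : Matrix B B ℝ) (i j : B) :
    HasDerivAt (fun t => semigroup L t i j) (-L i j) 0 := by
  open scoped Matrix.Norms.Operator in
  have h := hasDerivAt_exp_smul_const (𝕂 := ℝ) (-L) 0
  have h2 : HasDerivAt (fun t : ℝ => NormedSpace.exp (t • (-L)) i j)
      ((NormedSpace.exp ((0 : ℝ) • (-L)) * (-L)) i j) 0 :=
    (hasDerivAt_pi.1 ((hasDerivAt_pi.1 h) i)) j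
  simpa [semigroup, NormedSpace.exp_zero] using h2

lemma IsLindbladian.apply_nonpos {L : Matrix B B ℝ} (hL : IsLindbladian L) {i j : B}
    (hij : i ≠ j) : L i j ≤ 0 := by
  have h := (hasDerivAt_semigroup_apply L i j).hasDerivWithinAt (s := Set.Ioi 0)
  rw [hasDerivWithinAt_iff_tendsto_slope' (by simp)] at h
  have h2 : 0 ≤ -L i j := by
    refine ge_of_tendsto h ?_
    filter_upwards [self_mem_nhdsWithin] with t ht
    have h0 := (hL t (le_of_lt ht)).nonneg i j
    rw [slope_def_field, semigroup_zero, Matrix.one_apply_ne hij]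
    have ht' : (0 : ℝ) < t := ht
    exact div_nonneg (by linarith) (by linarith)
  linarith

lemma IsLindbladian.sum_col {L : Matrix B B ℝ} (hL : IsLindbladian L) (j : B) :
    ∑ i, L i j = 0 := by
  have h : HasDerivAt (fun t => ∑ i, semigroup L t i j) (∑ i, -L i j) 0 :=
    HasDerivAt.fun_sum fun i _ => hasDerivAt_semigroup_apply L i j
  have h1 := h.hasDerivWithinAt (s := Set.Ici 0)
  have h2 : HasDerivWithinAt (fun t => ∑ i, semigroup L t i j) 0 (Set.Ici 0) 0 :=
    (hasDerivWithinAt_const (0 : ℝ) (Set.Ici 0) (1 : ℝ)).congr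
      (fun t ht => (hL t ht).sum_col j) ((hL 0 le_rfl).sum_col j)
  have h3 := (uniqueDiffWithinAt_Ici (0 : ℝ)).eq_deriv _ h1 h2
  rw [Finset.sum_neg_distrib] at h3
  linarith

/-- Point masses on the extension by a one-point system test the diamond norm. -/
lemma sum_abs_col_le_diamondNorm (T : Matrix B B ℝ) (j : B) :
    ∑ i, |T i j| ≤ diamondNorm T := by
  refine le_csSup ⟨∑ i, ∑ j, |T i j|, ?_⟩ ⟨1, Pi.single (j, 0) 1, ?_, ?_⟩
  · rintro r ⟨n, X, hX, rfl⟩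
    simpa [hX] using l1Norm_kronecker_one_le T n X
  · simp [l1Norm, Pi.single_apply, apply_ite abs]
  · simp [l1Norm, Fintype.sum_prod_type]

lemma IsLindbladian.apply_self_le {L : Matrix B B ℝ} (hL : IsLindbladian L) (j : B) :
    L j j ≤ diamondNorm L / 2 := by
  have h1 := sum_abs_col_le_diamondNorm L j
  have h2 := hL.sum_col j
  rw [← Finset.add_sum_erase _ _ (Finset.mem_univ j)] at h1 h2
  have h3 : ∑ i ∈ Finset.univ.erase j, |L i j| = -∑ i ∈ Finset.univ.erase j, L i j := by
    rw [← Finset.sum_neg_distrib]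
    exact Finset.sum_congr rfl fun i hi =>
      abs_of_nonpos (hL.apply_nonpos (Finset.ne_of_mem_erase hi))
  have := le_abs_self (L j j)
  linarith

/-- The semigroup keeps at least the fraction `exp (-t ‖L‖_◇ / 2)` of every density in place:
`‖L‖_◇ / 2` bounds the jump rates. -/
lemma IsLindbladian.exp_smul_one_le {L : Matrix B B ℝ} (hL : IsLindbladian L) {t : ℝ}
    (ht : 0 ≤ t) (i j : B) :
    Real.exp (-(t * (diamondNorm L / 2))) * (1 : Matrix B B ℝ) i j ≤ semigroup L t i j := by
  set l := diamondNorm L / 2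
  have hsplit : semigroup L t = Real.exp (-(t * l)) • NormedSpace.exp (t • (l • 1 - L)) := by
    have hd : NormedSpace.exp ((-(t * l)) • (1 : Matrix B B ℝ)) = Real.exp (-(t * l)) • 1 := by
      rw [Matrix.smul_one_eq_diagonal, Matrix.smul_one_eq_diagonal, Matrix.exp_diagonal]
      congr 1
      funext x
      rw [Pi.exp_def]
      simp [Real.exp_eq_exp_ℝ]
    have hc : Commute ((-(t * l)) • (1 : Matrix B B ℝ)) (t • (l • 1 - L)) :=
      (Commute.one_left _).smul_left _
    unfold semigroup
    rw [show -(t • L) = (-(t * l)) • (1 : Matrix B B ℝ) + t • (l • 1 - L) by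
      rw [smul_sub, smul_smul, neg_smul]; abel,
      Matrix.exp_add_of_commute _ _ hc, hd, smul_mul_assoc,
      one_mul]
  rw [hsplit, Matrix.smul_apply, smul_eq_mul]
  refine mul_le_mul_of_nonneg_left (one_apply_le_exp_apply (fun i j => ?_) i j) (Real.exp_pos _).le
  rw [Matrix.smul_apply, smul_eq_mul]
  refine mul_nonneg ht ?_
  by_cases hij : i = j
  · subst hij
    have := hL.apply_self_le i
    simpa [l] using this
  · have := hL.apply_nonpos hij
    simpa [Matrix.one_apply_ne hij] using this

end Generator

end ClassicalDecay

/-! ### The fixed point projection and its ergodic classes -/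

namespace ClassicalDecay

section Projection

variable {B : Type*} [Fintype B] [DecidableEq B]

lemma IsFixedPointProjection.isChannel {L E : Matrix B B ℝ} (hL : IsLindbladian L)
    (hE : IsFixedPointProjection L E) : IsChannel E := by
  intro p hp
  refine (isClosed_stdSimplex ℝ B).mem_of_tendsto
    (((continuous_id.matrix_mulVec continuous_const).tendsto E).comp hE) ?_
  filter_upwards [eventually_ge_atTop 0] with t ht using hL t ht p hp

lemma IsFixedPointProjection.semigroup_mul {L E : Matrix B B ℝ}
    (hE : IsFixedPointProjection L E) (t : ℝ) : semigroup L t * E = E := by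
  have h1 : Tendsto (fun s => semigroup L t * semigroup L s) atTop (𝓝 (semigroup L t * E)) :=
    ((continuous_const.matrix_mul continuous_id).tendsto E).comp hE
  have h2 : Tendsto (fun s => semigroup L (t + s)) atTop (𝓝 E) :=
    hE.comp (tendsto_atTop_add_const_left _ t tendsto_id)
  simp only [semigroup_add] at h2
  exact tendsto_nhds_unique h1 h2

lemma IsFixedPointProjection.mul_self {L E : Matrix B B ℝ}
    (hE : IsFixedPointProjection L E) : E * E = E := by
  have h1 : Tendsto (fun s => semigroup L s * E) atTop (𝓝 (E * E)) :=
    ((continuous_id.matrix_mul continuous_const).tendsto E).comp hE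
  simp only [hE.semigroup_mul] at h1
  exact tendsto_nhds_unique h1 tendsto_const_nhds

/-- For classical systems the order `Id ≤_cp c E` is used only through the diagonal of `E`. -/
lemma CPLe.one_le_mul_apply_self {E : Matrix B B ℝ} {c : ℝ} (h : CPLe 1 (c • E)) (b : B) :
    1 ≤ c * E b b := by
  have h1 := h 1 _ (single_mem_stdSimplex ℝ (b, 0)) (b, 0)
  simpa using h1

/-- `P` is the moving part of weight `e` of a channel `(1 - e) Id + P` that fixes the range of the
idempotent channel `E`, where `E` keeps at least the fraction `1 / c` of every point mass in
place. -/
structure IsMovingPart (E P : Matrix B B ℝ) (c e : ℝ) : Prop where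
  proj : IsChannel E
  proj_mul_proj : E * E = E
  one_le : ∀ b, 1 ≤ c * E b b
  nonneg : ∀ i j, 0 ≤ P i j
  sum_col : ∀ j, ∑ i, P i j = e
  mul_proj : P * E = e • E

lemma isMovingPart_semigroup {L E : Matrix B B ℝ} (hL : IsLindbladian L)
    (hE : IsFixedPointProjection L E) {c : ℝ} (hc : CPLe 1 (c • E)) {t : ℝ} (ht : 0 ≤ t) :
    IsMovingPart E
      (semigroup L t - Real.exp (-(t * (diamondNorm L / 2))) • (1 : Matrix B B ℝ)) c
      (1 - Real.exp (-(t * (diamondNorm L / 2)))) where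
  proj := hE.isChannel hL
  proj_mul_proj := hE.mul_self
  one_le := hc.one_le_mul_apply_self
  nonneg i j := by
    have := hL.exp_smul_one_le ht i j
    simpa using this
  sum_col j := by
    simp [Finset.sum_sub_distrib, (hL t ht).sum_col j, Matrix.one_apply]
  mul_proj := by
    rw [Matrix.sub_mul, hE.semigroup_mul, Matrix.smul_mul, Matrix.one_mul, sub_smul, one_smul]

/-- The ergodic class of `b` under the idempotent channel `E`: the states that `E` reaches
from `b`. -/
noncomputable def ergodicClass (E : Matrix B B ℝ) (b : B) : Finset B :=
  Finset.univ.filter fun x => E x b ≠ 0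

lemma mem_ergodicClass {E : Matrix B B ℝ} {b x : B} : x ∈ ergodicClass E b ↔ E x b ≠ 0 := by
  simp [ergodicClass]

namespace IsMovingPart

variable {E P : Matrix B B ℝ} {c e : ℝ}

lemma proj_self_pos (h : IsMovingPart E P c e) (b : B) : 0 < E b b := by
  rcases (h.proj.nonneg b b).lt_or_eq with h0 | h0
  · exact h0
  · have := h.one_le b
    rw [← h0] at this
    norm_num at this

lemma proj_self_le_one (h : IsMovingPart E P c e) (b : B) : E b b ≤ 1 := by
  rw [← h.proj.sum_col b]
  exact Finset.single_le_sum (f := fun i => E i b) (fun i _ => h.proj.nonneg i b)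
    (Finset.mem_univ b)

lemma one_le_const (h : IsMovingPart E P c e) (b : B) : 1 ≤ c := by
  have h1 := h.one_le b
  have h2 := h.proj_self_pos b
  have h3 := h.proj_self_le_one b
  nlinarith

lemma weight_nonneg (h : IsMovingPart E P c e) (b : B) : 0 ≤ e := by
  rw [← h.sum_col b]
  exact Finset.sum_nonneg fun i _ => h.nonneg i b

/-- Points in the same class have the same column. Each row `v` of `E` is invariant under
averaging by `E`, and its variance under this averaging has expectation zero with respect to the
strictly positive fixed vector `E 1`. -/
lemma proj_apply_eq (h : IsMovingPart E P c e) {x b : B} (hx : E x b ≠ 0) (y : B) :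
    E y x = E y b := by
  set q : B → ℝ := fun i => ∑ j, E i j
  have hq : ∀ i, 0 < q i := fun i => lt_of_lt_of_le (h.proj_self_pos i)
    (Finset.single_le_sum (f := fun j => E i j) (fun j _ => h.proj.nonneg i j)
      (Finset.mem_univ i))
  have hEq : ∀ i, ∑ j, E i j * q j = q i := by
    intro i
    simp only [q, Finset.mul_sum]
    rw [Finset.sum_comm]
    refine Finset.sum_congr rfl fun j _ => ?_
    rw [← Matrix.mul_apply, h.proj_mul_proj]
  have hv : ∀ j, ∑ i, E y i * E i j = E y j := fun j => by
    rw [← Matrix.mul_apply, h.proj_mul_proj]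
  have hsum : ∑ j, ∑ i, q j * (E i j * (E y i - E y j) ^ 2) = 0 := by
    have h1 : ∀ j, ∑ i, q j * (E i j * (E y i - E y j) ^ 2)
        = ∑ i, q j * (E i j * E y i ^ 2) - q j * E y j ^ 2 := by
      intro j
      have : ∀ i, q j * (E i j * (E y i - E y j) ^ 2) = q j * (E i j * E y i ^ 2)
          - 2 * q j * E y j * (E y i * E i j) + q j * E y j ^ 2 * E i j := fun i => by ring
      simp only [this, Finset.sum_add_distrib, Finset.sum_sub_distrib, ← Finset.mul_sum, hv,
        h.proj.sum_col]
      ring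
    simp only [h1, Finset.sum_sub_distrib]
    rw [Finset.sum_comm, sub_eq_zero]
    refine Finset.sum_congr rfl fun i _ => ?_
    rw [← hEq i, Finset.sum_mul]
    exact Finset.sum_congr rfl fun j _ => by ring
  have hterm : ∀ j i, 0 ≤ q j * (E i j * (E y i - E y j) ^ 2) := fun j i =>
    mul_nonneg (hq j).le (mul_nonneg (h.proj.nonneg i j) (sq_nonneg _))
  have h2 := (Finset.sum_eq_zero_iff_of_nonneg
    (fun j _ => Finset.sum_nonneg fun i _ => hterm j i)).1 hsum b (Finset.mem_univ b)
  have h3 := (Finset.sum_eq_zero_iff_of_nonneg (fun i _ => hterm b i)).1 h2 x (Finset.mem_univ x)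
  have h4 : (E y x - E y b) ^ 2 = 0 := by
    simpa [(hq b).ne', hx] using h3
  exact sub_eq_zero.1 (pow_eq_zero_iff two_ne_zero |>.1 h4)

lemma self_mem_ergodicClass (h : IsMovingPart E P c e) (b : B) : b ∈ ergodicClass E b :=
  mem_ergodicClass.2 (h.proj_self_pos b).ne'

lemma ergodicClass_eq (h : IsMovingPart E P c e) {b x : B} (hx : x ∈ ergodicClass E b) :
    ergodicClass E x = ergodicClass E b := by
  ext y
  rw [mem_ergodicClass, mem_ergodicClass, h.proj_apply_eq (mem_ergodicClass.1 hx)]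

lemma mem_ergodicClass_symm (h : IsMovingPart E P c e) {b x : B} (hx : x ∈ ergodicClass E b) :
    b ∈ ergodicClass E x := by
  rw [h.ergodicClass_eq hx]
  exact h.self_mem_ergodicClass b

lemma proj_apply_eq_self (h : IsMovingPart E P c e) {b x : B} (hx : x ∈ ergodicClass E b) :
    E x b = E x x :=
  (h.proj_apply_eq (mem_ergodicClass.1 hx) x).symm

lemma proj_mulVec (h : IsMovingPart E P c e) (w : B → ℝ) (b : B) :
    (E *ᵥ w) b = E b b * ∑ x ∈ ergodicClass E b, w x := by
  rw [Matrix.mulVec, dotProduct, Finset.mul_sum]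
  symm
  refine Finset.sum_subset_zero_on_sdiff (Finset.subset_univ _) ?_ ?_
  · intro x hx
    have hx' : x ∉ ergodicClass E b := (Finset.mem_sdiff.1 hx).2
    have : E b x = 0 := by
      by_contra hne
      exact hx' (h.mem_ergodicClass_symm (mem_ergodicClass.2 hne))
    rw [this, zero_mul]
  · intro x hx
    rw [h.proj_apply_eq_self (h.mem_ergodicClass_symm hx)]

/-- `P = P Id ≤ c P E = c e E`: the moving part is dominated by the projection. -/
lemma apply_le_mul_proj (h : IsMovingPart E P c e) (b x : B) : P b x ≤ c * e * E b x := by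
  have h1 : ∑ y, P b y * E y x = e * E b x := by
    rw [← Matrix.mul_apply, h.mul_proj, Matrix.smul_apply, smul_eq_mul]
  have h2 : P b x * E x x ≤ e * E b x := by
    rw [← h1]
    exact Finset.single_le_sum (f := fun y => P b y * E y x)
      (fun y _ => mul_nonneg (h.nonneg _ _) (h.proj.nonneg _ _)) (Finset.mem_univ x)
  have hc : 0 ≤ c := zero_le_one.trans (h.one_le_const b)
  calc P b x ≤ P b x * (c * E x x) := le_mul_of_one_le_right (h.nonneg _ _) (h.one_le x)
    _ = c * (P b x * E x x) := by ring
    _ ≤ c * (e * E b x) := mul_le_mul_of_nonneg_left h2 hc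
    _ = _ := by ring

lemma apply_eq_zero (h : IsMovingPart E P c e) {b x : B} (hx : x ∉ ergodicClass E b) :
    P x b = 0 := by
  have h1 := h.apply_le_mul_proj x b
  have h2 : E x b = 0 := by
    by_contra hne
    exact hx (mem_ergodicClass.2 hne)
  rw [h2, mul_zero] at h1
  exact le_antisymm h1 (h.nonneg _ _)

lemma apply_eq_zero' (h : IsMovingPart E P c e) {b x : B} (hx : x ∉ ergodicClass E b) :
    P b x = 0 :=
  h.apply_eq_zero fun hb => hx (h.mem_ergodicClass_symm hb)

lemma apply_le (h : IsMovingPart E P c e) (b x : B) : P b x ≤ e := by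
  rw [← h.sum_col x]
  exact Finset.single_le_sum (f := fun i => P i x) (fun i _ => h.nonneg i x) (Finset.mem_univ b)

lemma sum_row_le (h : IsMovingPart E P c e) (b : B) : ∑ x, P b x ≤ c * e * E b b := by
  have h1 : ∑ y, P b y * E y b = e * E b b := by
    rw [← Matrix.mul_apply, h.mul_proj, Matrix.smul_apply, smul_eq_mul]
  rw [mul_assoc, ← h1, Finset.mul_sum]
  refine Finset.sum_le_sum fun y _ => ?_
  by_cases hy : y ∈ ergodicClass E b
  · rw [h.proj_apply_eq_self hy]
    have := mul_le_mul_of_nonneg_left (h.one_le y) (h.nonneg b y)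
    linarith
  · rw [h.apply_eq_zero' hy]
    simp

lemma proj_self_add_card_le (h : IsMovingPart E P c e) (b : B) :
    c * E b b + ((ergodicClass E b).card - 1) ≤ c := by
  have h1 : ∑ x ∈ ergodicClass E b, E x b = 1 := by
    rw [← h.proj.sum_col b]
    refine Finset.sum_subset (Finset.subset_univ _) fun x _ hx => ?_
    by_contra hne
    exact hx (mem_ergodicClass.2 hne)
  rw [← Finset.add_sum_erase _ _ (h.self_mem_ergodicClass b)] at h1
  have h2 : (((ergodicClass E b).erase b).card : ℝ)
      ≤ ∑ x ∈ (ergodicClass E b).erase b, c * E x b := by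
    have := Finset.card_nsmul_le_sum ((ergodicClass E b).erase b) (fun x => c * E x b) 1
      (fun x hx => by
        rw [h.proj_apply_eq_self (Finset.mem_of_mem_erase hx)]
        exact h.one_le x)
    simpa using this
  rw [← Finset.mul_sum] at h2
  have h3 : (((ergodicClass E b).erase b).card : ℝ) = (ergodicClass E b).card - 1 := by
    rw [Finset.card_erase_of_mem (h.self_mem_ergodicClass b), Nat.cast_sub, Nat.cast_one]
    exact Finset.card_pos.2 ⟨b, h.self_mem_ergodicClass b⟩
  rw [← h3]
  have h4 : c * E b b + c * ∑ x ∈ (ergodicClass E b).erase b, E x b = c := by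
    rw [← mul_add, h1, mul_one]
  linarith

end IsMovingPart

end Projection

end ClassicalDecay

/-! ### Loss of the quadratic form under the moving part -/

namespace ClassicalDecay

section Loss

variable {B : Type*} [Fintype B] [DecidableEq B]

/-- An upper bound for the relative loss, at the state `b`, of the quadratic form
`d ↦ ∑ b, d b ^ 2 / w b` under `(1 - e) Id + P`. It collects the jumps into and out of `b`; the
quotients with `w x = 0` are `0`. -/
noncomputable def lossCoef (P : Matrix B B ℝ) (w : B → ℝ) (b : B) : ℝ :=
  ∑ x, ((if b = x then 0 else P b x) * (1 + w x / w b)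
    + (if b = x then 0 else P x b) * (1 + w b / w x))

/-- The Cauchy–Schwarz inequality `(p - q) ^ 2 ≤ (1 / u + 1 / v) (u p ^ 2 + v q ^ 2)`, multiplied
by `v`; in this form it also holds for `u = 0`, where the quotient is `0`. -/
lemma mul_sub_sq_le {u v p q : ℝ} (hu : 0 ≤ u) (hp : u = 0 → p = 0) :
    v * (p - q) ^ 2 ≤ (1 + v / u) * (u * p ^ 2 + v * q ^ 2) := by
  rcases hu.eq_or_lt with h | h
  · subst h
    simp [hp rfl]
  · rw [show (1 + v / u) * (u * p ^ 2 + v * q ^ 2)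
      = v * (p - q) ^ 2 + (u * p + v * q) ^ 2 / u by field_simp; ring]
    have : 0 ≤ (u * p + v * q) ^ 2 / u := by positivity
    linarith

lemma two_mul_sub_le_sq_div {d w : ℝ} (hw : 0 ≤ w) (hd : w = 0 → d = 0) (r : ℝ) :
    2 * r * d - r ^ 2 * w ≤ d ^ 2 / w := by
  rcases hw.eq_or_lt with h | h
  · subst h
    simp [hd rfl]
  · rw [le_div_iff₀ h]
    nlinarith [sq_nonneg (d - r * w)]

lemma sum_jump_le_sum_lossCoef {P : Matrix B B ℝ} (hP : ∀ i j, 0 ≤ P i j) {w r : B → ℝ}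
    (hw : ∀ b, 0 ≤ w b) (hr : ∀ b, w b = 0 → r b = 0) :
    ∑ b, ∑ x, P b x * (w x * (r b - r x) ^ 2) ≤ ∑ b, lossCoef P w b * (w b * r b ^ 2) := by
  set F : B → B → ℝ := fun b x => (if b = x then 0 else P b x) * (1 + w x / w b)
  have hF : ∀ b x, P b x * (w x * (r b - r x) ^ 2)
      ≤ F b x * (w b * r b ^ 2) + F b x * (w x * r x ^ 2) := by
    intro b x
    by_cases hbx : b = x
    · subst hbx
      simp [F]
    · have := mul_le_mul_of_nonneg_left (mul_sub_sq_le (v := w x) (q := r x) (hw b) (hr b))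
        (hP b x)
      simp only [F, if_neg hbx]
      linarith
  calc ∑ b, ∑ x, P b x * (w x * (r b - r x) ^ 2)
      ≤ ∑ b, ∑ x, (F b x * (w b * r b ^ 2) + F b x * (w x * r x ^ 2)) :=
        Finset.sum_le_sum fun b _ => Finset.sum_le_sum fun x _ => hF b x
    _ = ∑ b, ∑ x, F b x * (w b * r b ^ 2) + ∑ b, ∑ x, F x b * (w b * r b ^ 2) := by
        simp only [Finset.sum_add_distrib]
        congr 1
        exact Finset.sum_comm
    _ = _ := by
        rw [← Finset.sum_add_distrib]
        refine Finset.sum_congr rfl fun b _ => ?_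
        rw [← Finset.sum_add_distrib, lossCoef, Finset.sum_mul]
        refine Finset.sum_congr rfl fun x _ => ?_
        simp only [F, eq_comm (a := x) (b := b)]
        ring

/-- The bound on the loss: test the variational formula
`d ^ 2 / w = max_r (2 r d - r ^ 2 w)` after the channel with the ratios `r = d / w` before it. -/
lemma sum_sq_div_sub_le {P : Matrix B B ℝ} {e : ℝ} (he : e ≤ 1) (hP : ∀ i j, 0 ≤ P i j)
    (hcol : ∀ j, ∑ i, P i j = e) {w d : B → ℝ} (hw : ∀ b, 0 ≤ w b)
    (hd : ∀ b, w b = 0 → d b = 0) :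
    ∑ b, (1 - lossCoef P w b) * (d b ^ 2 / w b) ≤
      ∑ b, ((1 - e) * d b + (P *ᵥ d) b) ^ 2 / ((1 - e) * w b + (P *ᵥ w) b) := by
  set r : B → ℝ := fun b => d b / w b
  have hr : ∀ b, w b = 0 → r b = 0 := fun b hb => by simp [r, hb]
  have hdr : ∀ b, d b = w b * r b := fun b => by
    by_cases hb : w b = 0
    · simp [hd b hb, hb]
    · simp only [r]
      field_simp
  have hX : ∀ b, d b ^ 2 / w b = w b * r b ^ 2 := fun b => by
    by_cases hb : w b = 0
    · simp [hb]
    · rw [hdr b]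
      field_simp
  have hPw : ∀ b, 0 ≤ (P *ᵥ w) b := fun b =>
    Finset.sum_nonneg fun x _ => mul_nonneg (hP b x) (hw x)
  have hzero : ∀ b, (1 - e) * w b + (P *ᵥ w) b = 0 → (1 - e) * d b + (P *ᵥ d) b = 0 := by
    intro b hb
    have h1 : 0 ≤ (1 - e) * w b := mul_nonneg (by linarith) (hw b)
    have h2 : (1 - e) * w b = 0 := by linarith [hPw b]
    have h3 : (P *ᵥ w) b = 0 := by linarith [hPw b]
    have h4 := (Finset.sum_eq_zero_iff_of_nonneg
      (fun x _ => mul_nonneg (hP b x) (hw x))).1 h3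
    have h5 : (P *ᵥ d) b = 0 := Finset.sum_eq_zero fun x hx => by
      rw [hdr x, ← mul_assoc, h4 x hx, zero_mul]
    rw [h5, hdr b, ← mul_assoc, h2]
    simp
  have hstep : ∑ b, (2 * r b * ((1 - e) * d b + (P *ᵥ d) b)
      - r b ^ 2 * ((1 - e) * w b + (P *ᵥ w) b))
      = ∑ b, w b * r b ^ 2 - ∑ b, ∑ x, P b x * (w x * (r b - r x) ^ 2) := by
    have h1 : ∑ b, ∑ x, P b x * (w x * r x ^ 2) = e * ∑ b, w b * r b ^ 2 := by
      rw [Finset.sum_comm, Finset.mul_sum]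
      refine Finset.sum_congr rfl fun x _ => ?_
      rw [← Finset.sum_mul, hcol]
    have h2 : ∀ b, ∑ x, P b x * (w x * (r b - r x) ^ 2)
        = r b ^ 2 * (P *ᵥ w) b - 2 * r b * (P *ᵥ d) b + ∑ x, P b x * (w x * r x ^ 2) := by
      intro b
      simp only [Matrix.mulVec, dotProduct, Finset.mul_sum]
      rw [← Finset.sum_sub_distrib, ← Finset.sum_add_distrib]
      refine Finset.sum_congr rfl fun x _ => ?_
      rw [hdr x]
      ring
    simp only [h2, Finset.sum_add_distrib, h1]
    rw [Finset.mul_sum, ← Finset.sum_add_distrib, ← Finset.sum_sub_distrib]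
    refine Finset.sum_congr rfl fun b _ => ?_
    rw [hdr b]
    ring
  have hjump := sum_jump_le_sum_lossCoef hP hw hr
  calc ∑ b, (1 - lossCoef P w b) * (d b ^ 2 / w b)
      = ∑ b, w b * r b ^ 2 - ∑ b, lossCoef P w b * (w b * r b ^ 2) := by
        rw [← Finset.sum_sub_distrib]
        exact Finset.sum_congr rfl fun b _ => by rw [hX]; ring
    _ ≤ _ := by
        refine le_trans ?_ (Finset.sum_le_sum fun b _ => two_mul_sub_le_sq_div
          (add_nonneg (mul_nonneg (by linarith) (hw b)) (hPw b)) (hzero b) (r b))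
        rw [hstep]
        linarith

namespace IsMovingPart

variable {E P : Matrix B B ℝ} {c e : ℝ}

lemma lossCoef_nonpos_of_card_eq_one (h : IsMovingPart E P c e) {b : B}
    (hcard : (ergodicClass E b).card = 1) (w : B → ℝ) : lossCoef P w b ≤ 0 := by
  obtain ⟨x0, hx0⟩ := Finset.card_eq_one.1 hcard
  have hb := h.self_mem_ergodicClass b
  refine le_of_eq (Finset.sum_eq_zero fun x _ => ?_)
  by_cases hbx : b = x
  · simp [hbx]
  · have hx : x ∉ ergodicClass E b := by
      rw [hx0, Finset.mem_singleton] at hb ⊢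
      exact fun hx => hbx (hb.trans hx.symm)
    simp [h.apply_eq_zero hx, h.apply_eq_zero' hx]

lemma lossCoef_le_of_eq_pair (h : IsMovingPart E P c e) {b x : B} (hbx : b ≠ x)
    (hcls : ergodicClass E b = {b, x}) {w : B → ℝ} (hw : ∀ b, 0 ≤ w b) :
    lossCoef P w b ≤ e * ((1 + w x / w b) + (1 + w b / w x)) := by
  have h1 : lossCoef P w b = P b x * (1 + w x / w b) + P x b * (1 + w b / w x) := by
    unfold lossCoef
    rw [Finset.sum_eq_single x]
    · simp [hbx]
    · intro y _ hyx
      by_cases hby : b = y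
      · simp [hby]
      · have hy : y ∉ ergodicClass E b := by
          rw [hcls]
          simp [hyx, Ne.symm hby]
        simp [h.apply_eq_zero hy, h.apply_eq_zero' hy]
    · simp
  have h2 := div_nonneg (hw x) (hw b)
  have h3 := div_nonneg (hw b) (hw x)
  rw [h1, mul_add e]
  exact add_le_add (mul_le_mul_of_nonneg_right (h.apply_le b x) (by linarith))
    (mul_le_mul_of_nonneg_right (h.apply_le x b) (by linarith))

/-- For a class of `n` states the loss coefficient exceeds the largest inverse relative weight `G`
in the class by at most `min (n, c - n + 2)`. -/
lemma lossCoef_le_of_forall_sum_le (h : IsMovingPart E P c e) {b : B} {w : B → ℝ}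
    (hw : ∀ b, 0 ≤ w b) (hb : 0 < w b) {G : ℝ}
    (hG : ∀ x ∈ ergodicClass E b, 0 < w x → ∑ y ∈ ergodicClass E b, w y ≤ G * w x) :
    lossCoef P w b ≤ e * (min ((ergodicClass E b).card - 1 : ℝ)
      (c - ((ergodicClass E b).card - 1)) + 1 + G) := by
  set S := ergodicClass E b with hS
  have hbS : b ∈ S := h.self_mem_ergodicClass b
  set M := ∑ y ∈ S, w y with hM
  have he := h.weight_nonneg b
  have hMw : w b ≤ M := Finset.single_le_sum (fun y _ => hw y) hbS
  have hMpos : 0 < M := hb.trans_le hMw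
  have hG0 : M ≤ G * w b := hG b hbS hb
  set F : B → B → ℝ := fun i j => if i = j then 0 else P i j
  have hF0 : ∀ i j, 0 ≤ F i j := fun i j => by
    simp only [F]; split_ifs; exacts [le_rfl, h.nonneg i j]
  have hFP : ∀ i j, F i j ≤ P i j := fun i j => by
    simp only [F]; split_ifs; exacts [h.nonneg i j, le_rfl]
  have hFS : ∀ x, x ∉ S.erase b → F b x = 0 ∧ F x b = 0 := by
    intro x hx
    by_cases hxb : x = b
    · simp [F, hxb]
    · have hxS : x ∉ S := fun hxS => hx (Finset.mem_erase.2 ⟨hxb, hxS⟩)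
      simp [F, h.apply_eq_zero hxS, h.apply_eq_zero' hxS]
  have hsplit : lossCoef P w b = ∑ x, F b x + ∑ x, F b x * (w x / w b) + ∑ x, F x b
      + ∑ x, F x b * (w b / w x) := by
    simp only [lossCoef, F, ← Finset.sum_add_distrib]
    refine Finset.sum_congr rfl fun x _ => ?_
    by_cases hbx : b = x
    · simp [hbx]
    · simp only [if_neg hbx, if_neg (Ne.symm hbx)]
      ring
  have hT1 : ∑ x, F b x ≤ e * min ((S.card : ℝ) - 1) (c - (S.card - 1)) := by
    rw [mul_min_of_nonneg _ _ he]
    refine le_min ?_ ?_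
    · rw [← Finset.sum_subset (Finset.subset_univ (S.erase b)) fun x _ hx => (hFS x hx).1]
      have := Finset.sum_le_card_nsmul (S.erase b) (fun x => F b x) e
        fun x _ => (hFP b x).trans (h.apply_le b x)
      rw [Finset.card_erase_of_mem hbS, nsmul_eq_mul, Nat.cast_sub (Finset.card_pos.2 ⟨b, hbS⟩),
        Nat.cast_one] at this
      linarith
    · have h1 := (Finset.sum_le_sum fun x (_ : x ∈ Finset.univ) => hFP b x).trans (h.sum_row_le b)
      have h2 := mul_le_mul_of_nonneg_left (h.proj_self_add_card_le b) he
      rw [← hS] at h2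
      nlinarith
  have hT2 : ∑ x, F b x * (w x / w b) ≤ e * ((M - w b) / w b) := by
    rw [← Finset.sum_subset (Finset.subset_univ (S.erase b))
      fun x _ hx => by rw [(hFS x hx).1, zero_mul]]
    rw [hM, ← Finset.add_sum_erase _ _ hbS, add_sub_cancel_left, Finset.sum_div, Finset.mul_sum]
    exact Finset.sum_le_sum fun x _ => mul_le_mul_of_nonneg_right
      ((hFP b x).trans (h.apply_le b x)) (div_nonneg (hw x) (hw b))
  have hT3 : ∑ x, F x b ≤ e := by
    rw [← h.sum_col b]
    exact Finset.sum_le_sum fun x _ => hFP x b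
  have hT4 : ∑ x, F x b * (w b / w x) ≤ e * (G * w b / M) := by
    have hGM : 0 ≤ G * w b / M := div_nonneg (hMpos.le.trans hG0) hMpos.le
    refine le_trans ?_ (mul_le_mul_of_nonneg_right hT3 hGM)
    rw [Finset.sum_mul]
    refine Finset.sum_le_sum fun x _ => ?_
    by_cases hx : x ∈ S.erase b
    · refine mul_le_mul_of_nonneg_left ?_ (hF0 x b)
      rcases (hw x).eq_or_lt with h0 | h0
      · rw [← h0, div_zero]
        exact hGM
      · rw [div_le_div_iff₀ h0 hMpos]
        have := mul_le_mul_of_nonneg_left (hG x (Finset.mem_of_mem_erase hx) h0) hb.le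
        linarith
    · rw [(hFS x hx).2, zero_mul, zero_mul]
  have hfin : (M - w b) / w b + G * w b / M ≤ G := by
    rw [div_add_div _ _ hb.ne' hMpos.ne', div_le_iff₀ (mul_pos hb hMpos)]
    nlinarith [mul_le_mul_of_nonneg_right hG0 (sub_nonneg.2 hMw)]
  have := mul_le_mul_of_nonneg_left hfin he
  rw [hsplit]
  linarith

end IsMovingPart

end Loss

end ClassicalDecay

/-! ### Numerical estimates for the loss coefficient -/

namespace ClassicalDecay

/-- The budget for the loss coefficient: with `γ = Y / c`, the bracket is
`c (1 + γ - 11/10 ε (γ ^ 2 + γ + 1))`, a lower bound for `c (1 - ε) / ε` times the loss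
`1 - (1 - ε) ^ 2 / ((1 - ε) + ε γ)`. -/
lemma le_one_sub_div_of_le_mul {c ε e Y G C : ℝ} (hc : 1 ≤ c) (hε0 : 0 ≤ ε) (hε : ε ≤ 1 / 64)
    (hY : 0 < Y) (hYG : Y ≤ c * G) (hce : c * e ≤ ε / (1 - ε))
    (he : 0 ≤ e)
    (hC : C ≤ e * (c + Y - 11 / 10 * ε * (Y ^ 2 / c + Y + c))) :
    C ≤ 1 - (1 - ε) ^ 2 / ((1 - ε) + ε * G) := by
  have hc0 : 0 < c := by linarith
  set γ := Y / c with hγ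
  have hγ0 : 0 < γ := div_pos hY hc0
  have hγG : γ ≤ G := by
    rw [hγ, div_le_iff₀ hc0]
    linarith
  have h1 : 0 < 1 - ε := by linarith
  have hd : 0 < (1 - ε) + ε * γ := by positivity
  have hmono : (1 - ε) ^ 2 / ((1 - ε) + ε * G) ≤ (1 - ε) ^ 2 / ((1 - ε) + ε * γ) := by
    refine div_le_div_of_nonneg_left (by positivity) hd ?_
    have := mul_le_mul_of_nonneg_left hγG hε0
    linarith
  refine le_trans ?_ (sub_le_sub_left hmono 1)
  set K := 1 + γ - 11 / 10 * ε * (γ ^ 2 + γ + 1)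
  have hK : e * (c + Y - 11 / 10 * ε * (Y ^ 2 / c + Y + c)) = c * e * K := by
    have hYc : Y = c * γ := by rw [hγ]; field_simp
    simp only [K]
    rw [hYc]
    field_simp
  rw [hK] at hC
  have hloss : 1 - (1 - ε) ^ 2 / ((1 - ε) + ε * γ)
      = ε * (1 - ε + γ) / ((1 - ε) + ε * γ) := by
    field_simp
    ring
  rw [hloss]
  by_cases hK0 : K ≤ 0
  · refine hC.trans (le_trans (mul_nonpos_of_nonneg_of_nonpos (by positivity) hK0) ?_)
    positivity
  · push Not at hK0
    refine hC.trans ((mul_le_mul_of_nonneg_right hce hK0.le).trans ?_)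
    rw [div_mul_eq_mul_div, div_le_div_iff₀ h1 hd, mul_assoc, mul_assoc]
    refine mul_le_mul_of_nonneg_left ?_ hε0
    have h2 : γ ^ 2 + γ + 1 ≤ 11 / 10 * (γ ^ 2 + γ + 1) * (1 - ε + ε * γ) := by
      have h3 : (1 : ℝ) ≤ 11 / 10 * (1 - ε + ε * γ) := by nlinarith [mul_nonneg hε0 hγ0.le]
      have h4 : 0 ≤ γ ^ 2 + γ + 1 := by positivity
      nlinarith
    have h5 := mul_le_mul_of_nonneg_left h2 hε0
    simp only [K]
    nlinarith [sq_nonneg ε]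

/-- Second-order terms in the noise are small compared with `a`. -/
lemma noise_mul_le {a m ε Y : ℝ} (ha0 : 0 < a) (hm0 : 0 < m) (hm : m ≤ 1 / 4)
    (hε : ε ≤ a * m ^ 3) (hY0 : 0 ≤ Y) (hY : m * Y ≤ 1) :
    ε * Y ^ 2 ≤ a / 4 ∧ ε * Y ≤ a / 16 ∧ ε ≤ a / 64 := by
  have hm2 : m ^ 2 ≤ 1 / 16 := by nlinarith
  have hY2 : (m * Y) ^ 2 ≤ 1 := by nlinarith [mul_nonneg hm0.le hY0]
  refine ⟨?_, ?_, ?_⟩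
  · calc ε * Y ^ 2 ≤ a * m ^ 3 * Y ^ 2 := by gcongr
      _ = a * m * (m * Y) ^ 2 := by ring
      _ ≤ a * m * 1 := by gcongr
      _ ≤ a / 4 := by nlinarith
  · calc ε * Y ≤ a * m ^ 3 * Y := by gcongr
      _ = a * m ^ 2 * (m * Y) := by ring
      _ ≤ a * m ^ 2 * 1 := by gcongr
      _ ≤ a / 16 := by nlinarith
  · calc ε ≤ a * m ^ 3 := hε
      _ = a * (m * m ^ 2) := by ring
      _ ≤ a * (1 / 4 * (1 / 16)) := by gcongr
      _ = a / 64 := by ring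

/-- The budget suffices for classes of at least three states, because of the slack
`c - min (n, c - n + 2)`. -/
lemma budget_of_three_le {a m ε c n k y z G : ℝ} (ha0 : 0 < a) (ha1 : a < 1) (hm0 : 0 < m)
    (hm : m ≤ 1 / 4) (hε : ε ≤ a * m ^ 3) (hn : 3 ≤ n) (hnc : n ≤ c)
    (hk1 : k ≤ n - 1) (hk2 : k ≤ c - (n - 1)) (hy : 1 ≤ y) (hmy : 2 * m * y ≤ 1)
    (hz : z ≤ 1 / 2) (hz2 : 2 * y * z ^ 2 ≤ a) (hG : G * (1 - z) ≤ y) :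
    k + 1 + G ≤ c + y * (1 + a)
      - 11 / 10 * ε * ((y * (1 + a)) ^ 2 / c + y * (1 + a) + c) := by
  -- the worst case of the excess `y z - y a ≤ y z - 2 (y z) ^ 2` is at `y z` of order one
  have h1 : G ≤ y * (1 + a) + 1 / 2 := by
    by_contra hcon
    push Not at hcon
    have h2 : (y * (1 + a) + 1 / 2) * (1 - z) < y := by nlinarith
    nlinarith [sq_nonneg (y * z - 1 / 2), mul_le_mul_of_nonneg_left hz2 (by linarith : 0 ≤ y),
      mul_nonneg (mul_nonneg ha0.le (by linarith : 0 ≤ y)) (by linarith : 0 ≤ 1 / 2 - z)]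
  have hY0 : 0 ≤ y * (1 + a) := by positivity
  have hmY : m * (y * (1 + a)) ≤ 1 := by nlinarith [mul_pos hm0 (by linarith : 0 < y)]
  obtain ⟨e1, e2, e3⟩ := noise_mul_le ha0 hm0 hm hε hY0 hmY
  have e4 : ε * ((y * (1 + a)) ^ 2 / c) ≤ 1 / 12 := by
    rw [← mul_div_assoc, div_le_iff₀ (by linarith)]
    linarith
  have e5 : ε * c ≤ 1 / 64 * c := mul_le_mul_of_nonneg_right (by linarith) (by linarith)
  linarith

/-- The budget suffices for classes of two states. Here `G` is the larger of the two inverse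
relative weights, and `G ^ 2 / (G - 1)` is their sum; `H` stands for `c g`. This is
the tight case: for `c = G = H = 2` the difference of the two sides vanishes with `a`. -/
lemma exists_budget_of_pair {a m ε c y z G H : ℝ} (ha0 : 0 < a) (ha1 : a < 1) (hm0 : 0 < m)
    (hm : m ≤ 1 / 4) (hε : ε ≤ a * m ^ 3) (hc : 2 ≤ c)
    (hmy : 2 * m * y ≤ 1) (hz0 : 0 ≤ z) (hz : z ≤ 1 / 2) (hz2 : 2 * y * z ^ 2 ≤ a)
    (hz3 : 4 * z ^ 2 ≤ a) (hG : G * (1 - z) ≤ y) (hG2 : 2 ≤ G) (hH : 2 ≤ H) (hyH : y ≤ H) :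
    ∃ Y, 0 < Y ∧ Y ≤ H * (1 + a) ∧
      G ^ 2 / (G - 1) ≤ c + Y - 11 / 10 * ε * (Y ^ 2 / c + Y + c) := by
  have key : ∀ Y : ℝ, 0 < Y → m * Y ≤ 1 → G ^ 2 / (G - 1) + a / 4 ≤ 2 + Y →
      G ^ 2 / (G - 1) ≤ c + Y - 11 / 10 * ε * (Y ^ 2 / c + Y + c) := by
    intro Y hY0 hmY h
    obtain ⟨e1, e2, e3⟩ := noise_mul_le ha0 hm0 hm hε hY0.le hmY
    have e4 : ε * (Y ^ 2 / c) ≤ a / 8 := by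
      rw [← mul_div_assoc, div_le_iff₀ (by linarith)]
      nlinarith
    have e5 : ε * (c - 2) ≤ 1 / 64 * (c - 2) := by
      gcongr
      linarith
    nlinarith
  have hG1 : 0 < G - 1 := by linarith
  have hsum : G ^ 2 / (G - 1) = G + 1 + 1 / (G - 1) := by
    field_simp
    ring
  by_cases hcase : G * (1 - z) ≤ 2
  · -- the weight after the perturbation is nearly balanced: the other state provides `H ≥ 2`
    refine ⟨2 * (1 + a), by positivity, by gcongr, key _ (by positivity) (by nlinarith) ?_⟩
    have hG4 : G ≤ 4 := by nlinarith
    have h1 : (G - 2) ^ 2 ≤ 16 / 3 * z ^ 2 * (G - 1) := by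
      have h2 : G - 2 ≤ G * z := by linarith
      have h3 : (G - 2) ^ 2 ≤ G ^ 2 * z ^ 2 := by nlinarith
      nlinarith [sq_nonneg z, mul_nonneg (sq_nonneg z)
        (by nlinarith : 0 ≤ 16 * (G - 1) - 3 * G ^ 2)]
    have h4 : G ^ 2 / (G - 1) ≤ 4 + 16 / 3 * z ^ 2 := by
      rw [div_le_iff₀ hG1]
      nlinarith
    linarith
  · -- with `k = G z ≤ G - 2`, the excess `k + 1 / (G - 1) - 1` is at most `k ^ 2 / (1 + k)`; the
    -- gain `a G (1 - z)` is at least `2 k ^ 2 (1 - z) ^ 2`, and `(1 + k) (1 - z) ^ 2 ≥ 1 - z ^ 2`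
    push Not at hcase
    have hz1 : 0 < 1 - z := by linarith
    refine ⟨G * (1 - z) * (1 + a), by positivity, by nlinarith, key _ (by positivity) ?_ ?_⟩
    · have : m * (G * (1 - z)) ≤ 1 / 2 := by nlinarith
      nlinarith [mul_pos hm0 (by linarith : 0 < G * (1 - z))]
    · rw [hsum]
      set v := G * (1 - z) with hv
      have hk0 : 0 ≤ G * z := by positivity
      have h1 : 1 / (G - 1) ≤ 1 / (1 + G * z) := by
        apply one_div_le_one_div_of_le (by linarith)
        linarith
      have h2 : 1 / (1 + G * z) ≤ 1 - G * z + 7 / 4 * v ^ 2 * z ^ 2 := by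
        rw [div_le_iff₀ (by linarith)]
        have h3 : 3 / 4 ≤ (1 + G * z) * (1 - z) ^ 2 := by
          have h4 : 2 * z ≤ G * z * (1 - z) := by nlinarith
          have h5 : (1 + z) ≤ (1 + G * z) * (1 - z) := by linarith
          nlinarith
        have h6 : v ^ 2 * z ^ 2 * (1 + G * z) = (G * z) ^ 2 * ((1 + G * z) * (1 - z) ^ 2) := by
          rw [hv]; ring
        nlinarith [sq_nonneg (G * z)]
      have h7 : 2 * v * z ^ 2 ≤ a := by nlinarith [sq_nonneg z]
      nlinarith

/-- The budget suffices for classes in which at most one state carries weight. -/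
lemma budget_of_le_two {ε c k : ℝ} (hc : 1 ≤ c) (hε : ε ≤ 1 / 64) (hk : k ≤ c)
    (hk2 : k ≤ 2) :
    k ≤ c + 1 - 11 / 10 * ε * (1 ^ 2 / c + 1 + c) := by
  have h1 : ε * (1 ^ 2 / c) ≤ 1 / 64 := by
    rw [← mul_div_assoc, div_le_iff₀ (by linarith)]
    linarith
  have h2 : ε * c ≤ 1 / 64 * c := mul_le_mul_of_nonneg_right hε (by linarith)
  linarith

section Site

variable {B : Type*} [Fintype B] [DecidableEq B]

/-- One slice of the interpolation between the product density and the density: `s` is the slice of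
the product, `w` the slice of the interpolated density. The bound `deviation` is what smallness of
the mutual information gives; it only concerns the states where `w` falls below `s`. The number `m`
is the smallest entry of the product density. -/
structure IsNearSlice (E : Matrix B B ℝ) (c a m g : ℝ) (s w : B → ℝ) : Prop where
  nonneg : ∀ b, 0 ≤ s b
  eq_zero : ∀ b, s b = 0 → w b = 0
  sum_eq : ∀ b, ∑ x ∈ ergodicClass E b, w x = ∑ x ∈ ergodicClass E b, s x
  sum_le : ∀ b, 0 < s b → ∑ x ∈ ergodicClass E b, s x ≤ c * g * s b
  deviation : ∀ b, w b < s b → (s b - w b) ^ 2 ≤ a * m ^ 2 * s b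
  le_apply : ∀ b, 0 < s b → m ≤ s b
  mul_sum_le : ∀ b, 0 < s b → 2 * m * ∑ x ∈ ergodicClass E b, s x ≤ s b

namespace IsNearSlice

variable {E P : Matrix B B ℝ} {c e a m g : ℝ} {s w : B → ℝ}

lemma half_le (h : IsNearSlice E c a m g s w) (ha1 : a < 1) (hm0 : 0 < m)
    (hm : m ≤ 1 / 4) (b : B) : s b / 2 ≤ w b := by
  rcases (h.nonneg b).eq_or_lt with h0 | h0
  · rw [← h0, h.eq_zero b h0.symm, zero_div]
  · by_cases hlt : w b < s b
    · have h1 := h.deviation b hlt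
      have h2 := h.le_apply b h0
      have h3 : a * m ^ 2 * s b ≤ (s b / 2) ^ 2 := by
        have h4 : a * m ^ 2 ≤ m ^ 2 := by nlinarith [sq_nonneg m]
        nlinarith [mul_le_mul_of_nonneg_right h4 h0.le,
          mul_nonneg hm0.le (mul_nonneg (by linarith : 0 ≤ 1 / 4 - m) h0.le)]
      have := abs_le_of_sq_le_sq' (h1.trans h3) (by linarith)
      linarith [this.2]
    · linarith

lemma nonneg' (h : IsNearSlice E c a m g s w) (ha1 : a < 1) (hm0 : 0 < m)
    (hm : m ≤ 1 / 4) (b : B) : 0 ≤ w b :=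
  le_trans (by linarith [h.nonneg b]) (h.half_le ha1 hm0 hm b)

/-- The relative weight `y` and the relative deviation `z` of a state, and their relations. -/
lemma exists_deviation (h : IsNearSlice E c a m g s w) (hE : IsMovingPart E P c e) (ha0 : 0 < a)
    (ha1 : a < 1) (hm0 : 0 < m) (hm : m ≤ 1 / 4) {b : B} (hb : 0 < s b) :
    ∃ y z : ℝ, y = (∑ x ∈ ergodicClass E b, s x) / s b ∧ 1 ≤ y ∧ 2 * m * y ≤ 1 ∧ y ≤ c * g ∧
      0 ≤ z ∧ z ≤ 1 / 2 ∧ 2 * y * z ^ 2 ≤ a ∧ 4 * z ^ 2 ≤ a ∧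
      (∑ x ∈ ergodicClass E b, w x) / w b * (1 - z) ≤ y := by
  have hwb : 0 < w b := by linarith [h.half_le ha1 hm0 hm b]
  set M := ∑ x ∈ ergodicClass E b, s x
  have hMs : s b ≤ M := Finset.single_le_sum (fun x _ => h.nonneg x) (hE.self_mem_ergodicClass b)
  have hM0 : 0 < M := hb.trans_le hMs
  have h4 : 2 * m * (M / s b) ≤ 1 := by
    rw [← mul_div_assoc, div_le_one hb]
    exact h.mul_sum_le b hb
  refine ⟨M / s b, max 0 (1 - w b / s b), rfl, (one_le_div hb).2 hMs, h4,
    (div_le_iff₀ hb).2 (h.sum_le b hb), le_max_left _ _, ?_, ?_, ?_, ?_⟩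
  · refine max_le (by norm_num) ?_
    have : 1 / 2 ≤ w b / s b := by
      rw [le_div_iff₀ hb]
      linarith [h.half_le ha1 hm0 hm b]
    linarith
  all_goals
    rcases le_or_gt (s b) (w b) with hle | hlt
    · have : 1 - w b / s b ≤ 0 := by
        have := (one_le_div hb).2 hle
        linarith
      rw [max_eq_left this]
      first
      | simpa using ha0.le
      | rw [sub_zero, mul_one, h.sum_eq b]
        exact div_le_div_of_nonneg_left hM0.le hb hle
    · have hlt' : 0 ≤ 1 - w b / s b := by
        have := (div_le_one hb).2 hlt.le
        linarith
      rw [max_eq_right hlt']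
      have hdev := h.deviation b hlt
      have hms := h.le_apply b hb
      have hz2 : (1 - w b / s b) ^ 2 ≤ a * (m ^ 2 / s b) := by
        rw [← mul_div_assoc, le_div_iff₀ hb]
        have : (1 - w b / s b) ^ 2 * s b = (s b - w b) ^ 2 / s b := by field_simp
        rw [this, div_le_iff₀ hb]
        exact hdev
      have hm2 : m ^ 2 / s b ≤ m := by
        rw [div_le_iff₀ hb]
        nlinarith
      first
      | calc 2 * (M / s b) * (1 - w b / s b) ^ 2 ≤ 2 * (M / s b) * (a * m) := by
              gcongr
              exact hz2.trans (by gcongr)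
          _ = a * (2 * m * (M / s b)) := by ring
          _ ≤ a * 1 := by gcongr
          _ = a := mul_one a
      | have h5 : (1 - w b / s b) ^ 2 ≤ a * m := hz2.trans (by gcongr)
        nlinarith
      | rw [sub_sub_cancel, h.sum_eq b]
        refine le_of_eq ?_
        change M / w b * (w b / s b) = M / s b
        field_simp

/-- The loss coefficient at every state fits the contraction factor of the noise that mixes the
fixed point into the density. -/
lemma lossCoef_le (h : IsNearSlice E c a m g s w) (hE : IsMovingPart E P c e) (ha0 : 0 < a)
    (ha1 : a < 1) (hm0 : 0 < m) (hm : m ≤ 1 / 4) {ε : ℝ} (hε0 : 0 ≤ ε) (hε : ε ≤ a * m ^ 3)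
    (hce : c * e ≤ ε / (1 - ε)) {b : B} (hb : 0 < s b) :
    lossCoef P w b ≤ 1 - (1 - ε) ^ 2 / ((1 - ε) + ε * (g / (1 - a))) := by
  have hw : ∀ b, 0 ≤ w b := h.nonneg' ha1 hm0 hm
  have hwpos : ∀ b, 0 < s b → 0 < w b := fun b hb => by linarith [h.half_le ha1 hm0 hm b]
  have hspos : ∀ b, 0 < w b → 0 < s b := fun b hb =>
    (h.nonneg b).lt_of_ne fun h0 => hb.ne' (h.eq_zero b h0.symm)
  have hc1 := hE.one_le_const b
  have he := hE.weight_nonneg b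
  have ha1' : 0 < 1 - a := by linarith
  have hcard := hE.proj_self_add_card_le b
  have hself := hE.one_le b
  obtain ⟨-, -, hε64⟩ := noise_mul_le (Y := 0) ha0 hm0 hm hε le_rfl (by simp)
  have hε1 : ε ≤ 1 / 64 := by linarith
  obtain ⟨yb, zb, hyb, hyb1, -, hybH, -⟩ := h.exists_deviation hE ha0 ha1 hm0 hm hb
  have hH0 : 0 < c * g := by linarith
  have hHa : c * g * (1 + a) ≤ c * (g / (1 - a)) := by
    rw [← mul_div_assoc, le_div_iff₀ ha1']
    nlinarith [sq_nonneg a]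
  have htriv : ∀ k : ℝ, k ≤ c → k ≤ 2 → lossCoef P w b ≤ e * k →
      lossCoef P w b ≤ 1 - (1 - ε) ^ 2 / ((1 - ε) + ε * (g / (1 - a))) := by
    intro k hkc hk2 hk
    refine le_one_sub_div_of_le_mul hc1 hε0 hε1 one_pos ?_ hce he
      (hk.trans (mul_le_mul_of_nonneg_left (budget_of_le_two hc1 hε1 hkc hk2) he))
    nlinarith
  have hcardpos : 1 ≤ (ergodicClass E b).card :=
    Finset.card_pos.2 ⟨b, hE.self_mem_ergodicClass b⟩
  obtain h1 | h2 | h3 : (ergodicClass E b).card = 1 ∨ (ergodicClass E b).card = 2 ∨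
      3 ≤ (ergodicClass E b).card := by omega
  · refine htriv 0 (by linarith) (by norm_num) ?_
    rw [mul_zero]
    exact hE.lossCoef_nonpos_of_card_eq_one h1 w
  · rw [h2] at hcard
    have hc2 : 2 ≤ c := by
      push_cast at hcard
      linarith
    obtain ⟨x, hbx, hcls⟩ : ∃ x, b ≠ x ∧ ergodicClass E b = {b, x} := by
      have hb' := hE.self_mem_ergodicClass b
      obtain ⟨x, hx⟩ := Finset.card_eq_one.1
        (by rw [Finset.card_erase_of_mem hb', h2] : ((ergodicClass E b).erase b).card = 1)
      have hxb : x ∈ (ergodicClass E b).erase b := by rw [hx]; exact Finset.mem_singleton_self x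
      refine ⟨x, (Finset.ne_of_mem_erase hxb).symm, ?_⟩
      rw [← Finset.insert_erase hb', hx]
    have hloss := hE.lossCoef_le_of_eq_pair hbx hcls hw
    rcases (h.nonneg x).eq_or_lt with hx0 | hx0
    · refine htriv 2 hc2 le_rfl (hloss.trans (le_of_eq ?_))
      rw [h.eq_zero x hx0.symm]
      norm_num
    · have hclsx : ergodicClass E x = {b, x} := by
        rw [hE.ergodicClass_eq (by rw [hcls]; simp), hcls]
      have hsb := h.sum_le b hb
      have hsx := h.sum_le x hx0
      rw [hcls, Finset.sum_pair hbx] at hsb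
      rw [hclsx, Finset.sum_pair hbx] at hsx
      have hH2 : 2 ≤ c * g := by
        by_contra hcon
        push Not at hcon
        nlinarith
      have hpb := hwpos b hb
      have hpx := hwpos x hx0
      -- the state of smaller weight controls the estimate
      have main : ∀ p q : B, ergodicClass E p = {b, x} → w p + w q = w b + w x → 0 < s p →
          0 < w q → w p ≤ w q →
          (1 + w x / w b) + (1 + w b / w x) = (1 + w q / w p) + (1 + w p / w q) →
          lossCoef P w b ≤ 1 - (1 - ε) ^ 2 / ((1 - ε) + ε * (g / (1 - a))) := by
        intro p q hp hpq hsp hq hle hsum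
        have hwp := hwpos p hsp
        obtain ⟨y, z, -, -, hmy, hyH, hz0, hz, hz2, hz3, hG⟩ :=
          h.exists_deviation hE ha0 ha1 hm0 hm hsp
        rw [hp, Finset.sum_pair hbx, ← hpq] at hG
        have hG2 : 2 ≤ (w p + w q) / w p := by
          rw [le_div_iff₀ hwp]
          linarith
        obtain ⟨Y, hY0, hYH, hY⟩ := exists_budget_of_pair ha0 ha1 hm0 hm hε hc2 hmy hz0 hz
          hz2 hz3 hG hG2 hH2 hyH
        refine le_one_sub_div_of_le_mul hc1 hε0 hε1 hY0 (hYH.trans hHa) hce he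
          (hloss.trans (mul_le_mul_of_nonneg_left (le_trans (le_of_eq ?_) hY) he))
        rw [hsum]
        have h5 : (w p + w q) / w p - 1 = w q / w p := by
          field_simp
          ring
        rw [h5]
        field_simp
        ring
      rcases le_total (w b) (w x) with hle | hle
      · exact main b x hcls rfl hb hpx hle rfl
      · exact main x b hclsx (add_comm _ _) hx0 hpb hle (add_comm _ _)
  · -- the inverse relative weight is largest at the state `x` of smallest weight
    have hne : ((ergodicClass E b).filter fun x => 0 < w x).Nonempty :=
      ⟨b, Finset.mem_filter.2 ⟨hE.self_mem_ergodicClass b, hwpos b hb⟩⟩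
    obtain ⟨x, hx, hmin⟩ := Finset.exists_min_image _ w hne
    obtain ⟨hxS, hwx⟩ := Finset.mem_filter.1 hx
    obtain ⟨y, z, -, hy1, hmy, hyH, hz0, hz, hz2, -, hG⟩ :=
      h.exists_deviation hE ha0 ha1 hm0 hm (hspos x hwx)
    rw [hE.ergodicClass_eq hxS] at hG
    have hM0 : 0 ≤ ∑ x ∈ ergodicClass E b, w x := Finset.sum_nonneg fun x _ => hw x
    have hloss := hE.lossCoef_le_of_forall_sum_le hw (hwpos b hb)
      (G := (∑ x ∈ ergodicClass E b, w x) / w x) (fun u hu hwu => by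
        have h6 := hmin u (Finset.mem_filter.2 ⟨hu, hwu⟩)
        rw [div_mul_eq_mul_div, le_div_iff₀ hwx]
        gcongr)
    have h3' : (3 : ℝ) ≤ (ergodicClass E b).card := by exact_mod_cast h3
    refine le_one_sub_div_of_le_mul hc1 hε0 hε1 (Y := y * (1 + a)) (by positivity) ?_ hce he
      (hloss.trans (mul_le_mul_of_nonneg_left (budget_of_three_le ha0 ha1 hm0 hm hε h3'
        (by linarith) (min_le_left _ _) (min_le_right _ _) hy1 hmy hz hz2 hG) he))
    exact le_trans (by gcongr) hHa

end IsNearSlice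

end Site

end ClassicalDecay

/-! ### Relative entropy -/

namespace ClassicalDecay

lemma mul_log_sub_log_sub_add_nonneg {x y : ℝ} (hx : 0 ≤ x) (hy : 0 < y) :
    0 ≤ x * (Real.log x - Real.log y) - x + y := by
  rcases hx.eq_or_lt with h | h
  · rw [← h]
    simpa using hy.le
  · have h1 := Real.log_le_sub_one_of_pos (div_pos hy h)
    rw [Real.log_div hy.ne' h.ne'] at h1
    have h2 := mul_le_mul_of_nonneg_left h1 h.le
    have h3 : x * (y / x - 1) = y - x := by field_simp
    linarith

/-- A quadratic lower bound below the reference point, from `t ≤ sinh t` for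
`t = log y - log x`. -/
lemma sq_le_two_mul_mul_log_sub_log {x y : ℝ} (hx : 0 ≤ x) (hxy : x ≤ y) (hy : 0 < y) :
    (y - x) ^ 2 ≤ 2 * y * (x * (Real.log x - Real.log y) - x + y) := by
  rcases hx.eq_or_lt with h | h
  · rw [← h]
    simp only [zero_mul, sub_zero, zero_add]
    nlinarith
  · have ht : 0 ≤ Real.log y - Real.log x := sub_nonneg.2 (Real.log_le_log h hxy)
    have h1 := Real.self_le_sinh_iff.2 ht
    rw [Real.sinh_eq, neg_sub, Real.exp_sub, Real.exp_sub, Real.exp_log h, Real.exp_log hy] at h1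
    have h2 := mul_le_mul_of_nonneg_left h1 (mul_nonneg hy.le h.le)
    have h3 : y * x * ((y / x - x / y) / 2) = (y ^ 2 - x ^ 2) / 2 := by field_simp
    nlinarith

lemma relEntropy_eq_sum {ι : Type*} [Fintype ι] {p q : ι → ℝ} (h : ∑ i, p i = ∑ i, q i) :
    relEntropy p q = ∑ i, (p i * (Real.log (p i) - Real.log (q i)) - p i + q i) := by
  rw [Finset.sum_add_distrib, Finset.sum_sub_distrib, h]
  simp [relEntropy]

lemma relEntropy_nonneg {ι : Type*} [Fintype ι] {p q : ι → ℝ} (h : ∑ i, p i = ∑ i, q i)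
    (hp : ∀ i, 0 ≤ p i) (hq : ∀ i, 0 ≤ q i) (hpq : ∀ i, q i = 0 → p i = 0) :
    0 ≤ relEntropy p q := by
  rw [relEntropy_eq_sum h]
  refine Finset.sum_nonneg fun i _ => ?_
  rcases (hq i).eq_or_lt with h0 | h0
  · simp [hpq i h0.symm, ← h0]
  · exact mul_log_sub_log_sub_add_nonneg (hp i) h0

lemma sq_le_two_mul_mul_relEntropy {ι : Type*} [Fintype ι] {p q : ι → ℝ}
    (h : ∑ i, p i = ∑ i, q i) (hp : ∀ i, 0 ≤ p i) (hq : ∀ i, 0 ≤ q i)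
    (hpq : ∀ i, q i = 0 → p i = 0) {i : ι} (hi : p i ≤ q i) :
    (q i - p i) ^ 2 ≤ 2 * q i * relEntropy p q := by
  rcases (hq i).eq_or_lt with h0 | h0
  · simp [hpq i h0.symm, ← h0]
  · refine (sq_le_two_mul_mul_log_sub_log (hp i) hi h0).trans
      (mul_le_mul_of_nonneg_left ?_ (by positivity))
    rw [relEntropy_eq_sum h]
    refine Finset.single_le_sum
      (f := fun i => p i * (Real.log (p i) - Real.log (q i)) - p i + q i)
      (fun j _ => ?_) (Finset.mem_univ i)
    rcases (hq j).eq_or_lt with h1 | h1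
    · simp [hpq j h1.symm, ← h1]
    · exact mul_log_sub_log_sub_add_nonneg (hp j) h1

/-- A function on `[0, 1]` with nonnegative second derivative that vanishes to first order at `0`
is nonnegative at `1`. -/
lemma nonneg_of_hasDerivAt_of_nonneg {f f' f'' : ℝ → ℝ}
    (hf : ∀ u ∈ Set.Icc (0 : ℝ) 1, HasDerivAt f (f' u) u)
    (hf' : ∀ u ∈ Set.Icc (0 : ℝ) 1, HasDerivAt f' (f'' u) u)
    (hf'' : ∀ u ∈ Set.Icc (0 : ℝ) 1, 0 ≤ f'' u) (h0 : f 0 = 0) (h0' : f' 0 = 0) : 0 ≤ f 1 := by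
  have mono : ∀ g g' : ℝ → ℝ, (∀ u ∈ Set.Icc (0 : ℝ) 1, HasDerivAt g (g' u) u) →
      (∀ u ∈ Set.Icc (0 : ℝ) 1, 0 ≤ g' u) → MonotoneOn g (Set.Icc 0 1) := by
    intro g g' hg hg'
    refine monotoneOn_of_deriv_nonneg (convex_Icc 0 1)
      (fun u hu => (hg u hu).continuousAt.continuousWithinAt)
      (fun u hu => (hg u (interior_subset hu)).differentiableAt.differentiableWithinAt)
      (fun u hu => ?_)
    rw [(hg u (interior_subset hu)).deriv]
    exact hg' u (interior_subset hu)
  have h01 : (0 : ℝ) ∈ Set.Icc (0 : ℝ) 1 := by simp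
  have h1 := mono f' f'' hf' hf''
  have h2 := mono f f' hf fun u hu => by
    rw [← h0']
    exact h1 h01 hu hu.1
  rw [← h0]
  exact h2 h01 (by simp) zero_le_one

section Interpolation

variable {ι : Type*} [Fintype ι]

/-- The relative entropy to `q` along the segment `q + u d`, normalized so that its first
derivative at `u = 0` vanishes. -/
noncomputable def segmentEntropy (q d : ι → ℝ) (u : ℝ) : ℝ :=
  ∑ i, ((q i + u * d i) * (Real.log (q i + u * d i) - Real.log (q i)) - u * d i)

lemma hasDerivAt_segmentEntropy {q d : ι → ℝ} {u : ℝ} (hd : ∀ i, q i = 0 → d i = 0)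
    (hu : ∀ i, q i ≠ 0 → 0 < q i + u * d i) :
    HasDerivAt (segmentEntropy q d)
      (∑ i, d i * (Real.log (q i + u * d i) - Real.log (q i))) u := by
  unfold segmentEntropy
  refine HasDerivAt.fun_sum fun i _ => ?_
  by_cases hq : q i = 0
  · simp only [hq, hd i hq]
    simpa using hasDerivAt_const u (0 : ℝ)
  · have h1 : HasDerivAt (fun u => q i + u * d i) (d i) u := by
      simpa using ((hasDerivAt_id u).mul_const (d i)).const_add (q i)
    have hpos := hu i hq
    have h2 := (h1.mul ((h1.log hpos.ne').sub_const (Real.log (q i)))).sub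
      ((hasDerivAt_id u).mul_const (d i))
    refine h2.congr_deriv ?_
    rw [mul_div_cancel₀ _ hpos.ne']
    ring

lemma hasDerivAt_segmentEntropy_deriv {q d : ι → ℝ} {u : ℝ} (hd : ∀ i, q i = 0 → d i = 0)
    (hu : ∀ i, q i ≠ 0 → 0 < q i + u * d i) :
    HasDerivAt (fun u => ∑ i, d i * (Real.log (q i + u * d i) - Real.log (q i)))
      (∑ i, d i ^ 2 / (q i + u * d i)) u := by
  refine HasDerivAt.fun_sum fun i _ => ?_
  by_cases hq : q i = 0
  · simp only [hq, hd i hq]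
    simpa using hasDerivAt_const u (0 : ℝ)
  · have h1 : HasDerivAt (fun u => q i + u * d i) (d i) u := by
      simpa using ((hasDerivAt_id u).mul_const (d i)).const_add (q i)
    refine (((h1.log (hu i hq).ne').sub_const (Real.log (q i))).const_mul (d i)).congr_deriv ?_
    ring

lemma segmentEntropy_one {q d : ι → ℝ} (hd : ∑ i, d i = 0) :
    segmentEntropy q d 1 = relEntropy (fun i => q i + d i) q := by
  simp [segmentEntropy, relEntropy, Finset.sum_sub_distrib, hd]

/-- A comparison of the second derivatives along two segments gives a comparison of the relative
entropies at their ends. -/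
lemma mul_relEntropy_le_of_forall {κ : Type*} [Fintype κ] {q d : ι → ℝ} {q' d' : κ → ℝ} {F : ℝ}
    (hd : ∀ i, q i = 0 → d i = 0) (hd' : ∀ i, q' i = 0 → d' i = 0)
    (hsum : ∑ i, d i = 0) (hsum' : ∑ i, d' i = 0)
    (hu : ∀ u ∈ Set.Icc (0 : ℝ) 1, ∀ i, q i ≠ 0 → 0 < q i + u * d i)
    (hu' : ∀ u ∈ Set.Icc (0 : ℝ) 1, ∀ i, q' i ≠ 0 → 0 < q' i + u * d' i)
    (hF : ∀ u ∈ Set.Icc (0 : ℝ) 1,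
      F * ∑ i, d i ^ 2 / (q i + u * d i) ≤ ∑ i, d' i ^ 2 / (q' i + u * d' i)) :
    F * relEntropy (fun i => q i + d i) q ≤ relEntropy (fun i => q' i + d' i) q' := by
  have h := nonneg_of_hasDerivAt_of_nonneg
    (f := fun u => segmentEntropy q' d' u - F * segmentEntropy q d u)
    (fun u hI => (hasDerivAt_segmentEntropy hd' (hu' u hI)).sub
      ((hasDerivAt_segmentEntropy hd (hu u hI)).const_mul F))
    (fun u hI => (hasDerivAt_segmentEntropy_deriv hd' (hu' u hI)).sub
      ((hasDerivAt_segmentEntropy_deriv hd (hu u hI)).const_mul F))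
    (fun u hI => sub_nonneg.2 (hF u hI)) (by simp [segmentEntropy]) (by simp)
  simp only [segmentEntropy_one hsum, segmentEntropy_one hsum'] at h
  linarith

end Interpolation

/-! ### Bipartite densities -/

section Bipartite

variable {A B : Type*} [Fintype A] [DecidableEq A] [Fintype B] [DecidableEq B]

lemma actB_apply (T : Matrix B B ℝ) (r : A × B → ℝ) (a : A) (b : B) :
    actB T r (a, b) = (T *ᵥ fun x => r (a, x)) b := by
  simp [actB, Matrix.mulVec, dotProduct, Fintype.sum_prod_type, Matrix.one_apply]

lemma sum_mulVec {T : Matrix B B ℝ} {k : ℝ} (hT : ∀ j, ∑ i, T i j = k) (v : B → ℝ) :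
    ∑ b, (T *ᵥ v) b = k * ∑ b, v b := by
  simp only [Matrix.mulVec, dotProduct]
  rw [Finset.sum_comm, Finset.mul_sum]
  exact Finset.sum_congr rfl fun x _ => by rw [← Finset.sum_mul, hT]

lemma margA_actB {T : Matrix B B ℝ} (hT : ∀ j, ∑ i, T i j = 1) (r : A × B → ℝ) :
    margA (actB T r) = margA r := by
  funext a
  simp only [margA, actB_apply]
  rw [sum_mulVec hT, one_mul]

lemma margB_actB (T : Matrix B B ℝ) (r : A × B → ℝ) : margB (actB T r) = T *ᵥ margB r := by
  funext b
  simp only [margB, actB_apply, Matrix.mulVec, dotProduct]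
  rw [Finset.sum_comm]
  exact Finset.sum_congr rfl fun x _ => by rw [Finset.mul_sum]

lemma actB_prodDensity (T : Matrix B B ℝ) (p : A → ℝ) (q : B → ℝ) :
    actB T (prodDensity p q) = prodDensity p (T *ᵥ q) := by
  funext x
  obtain ⟨a, b⟩ := x
  simp only [actB_apply, prodDensity, Matrix.mulVec, dotProduct, Finset.mul_sum]
  exact Finset.sum_congr rfl fun x _ => by ring

lemma mutualInfo_actB {T : Matrix B B ℝ} (hT : ∀ j, ∑ i, T i j = 1) (r : A × B → ℝ) :
    mutualInfo (actB T r)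
      = relEntropy (actB T r) (actB T (prodDensity (margA r) (margB r))) := by
  rw [mutualInfo, margA_actB hT, margB_actB, actB_prodDensity]

lemma sum_margA (r : A × B → ℝ) : ∑ a, margA r a = ∑ x, r x := by
  rw [Fintype.sum_prod_type]
  rfl

lemma sum_margB (r : A × B → ℝ) : ∑ b, margB r b = ∑ x, r x := by
  rw [Fintype.sum_prod_type_right]
  rfl

lemma sum_prodDensity (p : A → ℝ) (q : B → ℝ) :
    ∑ x, prodDensity p q x = (∑ a, p a) * ∑ b, q b := by
  rw [Fintype.sum_prod_type, Finset.sum_mul_sum]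
  rfl

lemma prodDensity_marg_eq_zero {r : A × B → ℝ} (hr : ∀ x, 0 ≤ r x) {x : A × B}
    (hx : prodDensity (margA r) (margB r) x = 0) : r x = 0 := by
  rcases mul_eq_zero.1 hx with h | h
  · exact (Finset.sum_eq_zero_iff_of_nonneg fun b _ => hr (x.1, b)).1 h x.2 (Finset.mem_univ _)
  · exact (Finset.sum_eq_zero_iff_of_nonneg fun a _ => hr (a, x.2)).1 h x.1 (Finset.mem_univ _)

lemma mutualInfo_nonneg {r : A × B → ℝ} (hr : r ∈ stdSimplex ℝ (A × B)) : 0 ≤ mutualInfo r := by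
  refine relEntropy_nonneg ?_ hr.1 (fun x => mul_nonneg ?_ ?_)
    fun x => prodDensity_marg_eq_zero hr.1
  · rw [sum_prodDensity, sum_margA, sum_margB, hr.2, one_mul]
  · exact Finset.sum_nonneg fun b _ => hr.1 _
  · exact Finset.sum_nonneg fun b _ => hr.1 _

lemma actB_mem_stdSimplex {T : Matrix B B ℝ} (hT : IsChannel T) {r : A × B → ℝ}
    (hr : r ∈ stdSimplex ℝ (A × B)) : actB T r ∈ stdSimplex ℝ (A × B) := by
  refine ⟨fun x => ?_, ?_⟩
  · obtain ⟨a, b⟩ := x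
    rw [actB_apply]
    exact Finset.sum_nonneg fun x _ => mul_nonneg (hT.nonneg b x) (hr.1 _)
  · rw [← sum_margA, margA_actB hT.sum_col, sum_margA, hr.2]

/-- Continuity bound: the moved part of weight `e` costs at most the entropy `h(e)` of the mixture
and the logarithm of the growth of the product density, which is at most `1 - e + e / m` where its
entries are at least `m`. The moved part itself has nonnegative relative entropy. -/
lemma mul_mutualInfo_sub_le {T P : Matrix B B ℝ} {e m : ℝ} (he1 : e < 1)
    (he0 : 0 ≤ e) (hP : ∀ i j, 0 ≤ P i j) (hcol : ∀ j, ∑ i, P i j = e)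
    (hT : T = (1 - e) • (1 : Matrix B B ℝ) + P) (hm0 : 0 < m) {r : A × B → ℝ}
    (hr : r ∈ stdSimplex ℝ (A × B))
    (hm : ∀ x, prodDensity (margA r) (margB r) x ≠ 0 → m ≤ prodDensity (margA r) (margB r) x) :
    (1 - e) * mutualInfo r - Real.binEntropy e - (1 - e) * Real.log ((1 - e) + e * m⁻¹)
      ≤ mutualInfo (actB T r) := by
  set σ := prodDensity (margA r) (margB r) with hσ
  have hσ0 : ∀ x, 0 ≤ σ x := fun x => mul_nonneg (Finset.sum_nonneg fun b _ => hr.1 _)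
    (Finset.sum_nonneg fun b _ => hr.1 _)
  have hσ1 : ∑ x, σ x = 1 := by
    rw [hσ, sum_prodDensity, sum_margA, sum_margB, hr.2, one_mul]
  have hsupp : ∀ x, σ x = 0 → r x = 0 := fun x => prodDensity_marg_eq_zero hr.1
  have hTcol : ∀ j, ∑ i, T i j = 1 := fun j => by
    simp [hT, Finset.sum_add_distrib, hcol, Matrix.one_apply]
  have hact : ∀ v : A × B → ℝ, ∀ x, actB T v x = (1 - e) * v x + actB P v x := by
    rintro v ⟨a, b⟩
    simp [actB_apply, hT, Matrix.add_mulVec, Matrix.smul_mulVec]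
  have hPnn : ∀ v : A × B → ℝ, (∀ x, 0 ≤ v x) → ∀ x, 0 ≤ actB P v x := by
    rintro v hv ⟨a, b⟩
    rw [actB_apply]
    exact Finset.sum_nonneg fun x _ => mul_nonneg (hP _ _) (hv _)
  have hPsum : ∀ v : A × B → ℝ, ∑ x, actB P v x = e * ∑ x, v x := by
    intro v
    rw [Fintype.sum_prod_type, Fintype.sum_prod_type, Finset.mul_sum]
    simp only [actB_apply]
    exact Finset.sum_congr rfl fun a _ => sum_mulVec hcol _
  have hPle : ∀ x, actB P σ x ≤ e := by
    rw [← mul_one e, ← hσ1, ← hPsum]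
    exact fun x => Finset.single_le_sum (fun y _ => hPnn σ hσ0 y) (Finset.mem_univ x)
  have hPsupp : ∀ x, actB P σ x = 0 → actB P r x = 0 := by
    rintro ⟨a, b⟩ h
    rw [actB_apply] at h ⊢
    have h1 := (Finset.sum_eq_zero_iff_of_nonneg
      (fun x _ => mul_nonneg (hP b x) (hσ0 (a, x)))).1 h
    refine Finset.sum_eq_zero fun x hx => ?_
    change P b x * r (a, x) = 0
    rcases mul_eq_zero.1 (h1 x hx) with h2 | h2
    · rw [h2, zero_mul]
    · rw [hsupp _ h2, mul_zero]
  have he1' : 0 < 1 - e := by linarith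
  have hk : 0 < (1 - e) + e * m⁻¹ := by positivity
  have hpt : ∀ x, (1 - e) * (r x * (Real.log (r x) - Real.log (σ x)))
      + (1 - e) * (Real.log (1 - e) - Real.log ((1 - e) + e * m⁻¹)) * r x
      + (Real.log e + 1) * actB P r x - e * actB T σ x
      ≤ actB T r x * (Real.log (actB T r x) - Real.log (actB T σ x)) := by
    intro x
    have hη0 := hPnn r hr.1 x
    have hρ0 := hr.1 x
    have hθ0 := hPnn σ hσ0 x
    have hρ'0 : 0 ≤ actB T r x := by rw [hact]; positivity
    have hσ'0 : 0 ≤ actB T σ x := by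
      rw [hact]; have := hσ0 x; positivity
    have first : (1 - e) * (r x * (Real.log (r x) - Real.log (σ x)))
        + (1 - e) * (Real.log (1 - e) - Real.log ((1 - e) + e * m⁻¹)) * r x
        ≤ (1 - e) * r x * (Real.log (actB T r x) - Real.log (actB T σ x)) := by
      rcases hρ0.eq_or_lt with h0 | h0
      · simp [← h0]
      · have hσpos : 0 < σ x := (hσ0 x).lt_of_ne fun h => h0.ne' (hsupp x h.symm)
        have hmσ := hm x hσpos.ne'
        have h1 : Real.log (1 - e) + Real.log (r x) ≤ Real.log (actB T r x) := by
          rw [← Real.log_mul he1'.ne' h0.ne']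
          refine Real.log_le_log (by positivity) ?_
          rw [hact]
          linarith
        have h2 : Real.log (actB T σ x) ≤ Real.log ((1 - e) + e * m⁻¹) + Real.log (σ x) := by
          rw [← Real.log_mul hk.ne' hσpos.ne']
          refine Real.log_le_log ?_ ?_
          · rw [hact]
            positivity
          · rw [hact, add_mul]
            have h3 : 1 ≤ m⁻¹ * σ x := by
              rw [inv_mul_eq_div, one_le_div hm0]
              exact hmσ
            have h4 := mul_le_mul_of_nonneg_left h3 he0
            linarith [hPle x]
        have h5 : 0 ≤ (1 - e) * r x := by positivity
        have h6 := mul_le_mul_of_nonneg_left (add_le_add h1 (neg_le_neg h2)) h5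
        linarith
    have second : (Real.log e + 1) * actB P r x - e * actB T σ x
        ≤ actB P r x * (Real.log (actB T r x) - Real.log (actB T σ x)) := by
      rcases hη0.eq_or_lt with h0 | h0
      · rw [← h0]
        simpa using mul_nonneg he0 hσ'0
      · have hθ : 0 < actB P σ x := hθ0.lt_of_ne fun h => h0.ne' (hPsupp x h.symm)
        have hσ' : 0 < actB T σ x := by
          rw [hact]; have := hσ0 x; positivity
        have hepos : 0 < e := he0.lt_of_ne fun h => by
          have := hPle x
          linarith
        have h1 := mul_log_sub_log_sub_add_nonneg h0.le (mul_pos hepos hσ')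
        rw [Real.log_mul hepos.ne' hσ'.ne'] at h1
        have h2 : Real.log (actB P r x) ≤ Real.log (actB T r x) := by
          refine Real.log_le_log h0 ?_
          rw [hact]
          have : 0 ≤ (1 - e) * r x := by positivity
          linarith
        have h3 := mul_le_mul_of_nonneg_left h2 h0.le
        linarith
    calc _ ≤ (1 - e) * r x * (Real.log (actB T r x) - Real.log (actB T σ x))
          + actB P r x * (Real.log (actB T r x) - Real.log (actB T σ x)) := by linarith
      _ = _ := by
        rw [← add_mul, ← hact]
  rw [mutualInfo_actB hTcol, relEntropy, ← hσ]
  refine le_trans (le_of_eq ?_) (Finset.sum_le_sum fun x _ => hpt x)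
  have hTσ : ∑ x, actB T σ x = 1 := by
    rw [← sum_margA, margA_actB hTcol, sum_margA, hσ1]
  rw [Finset.sum_sub_distrib, Finset.sum_add_distrib, Finset.sum_add_distrib, ← Finset.mul_sum,
    ← Finset.mul_sum, ← Finset.mul_sum, ← Finset.mul_sum, hr.2, hPsum, hr.2, hTσ, mutualInfo,
    relEntropy, ← hσ, Real.binEntropy, Real.log_inv, Real.log_inv]
  ring

end Bipartite

end ClassicalDecay

/-! ### The smallest entry and the noise parameter -/

namespace ClassicalDecay

section Constants

variable {A B : Type*} [Fintype A] [DecidableEq A] [Fintype B] [DecidableEq B]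

/-- The infimum is attained, as it is taken over a finite nonempty set of nonzero entries. -/
lemma minEntry_pos {p : A → ℝ} {q w : B → ℝ} (hp : ∀ a, 0 ≤ p a) (hq : ∀ b, 0 ≤ q b)
    (hw : ∀ b, 0 ≤ w b) {x : A × B} (hx : prodDensity p q x ≠ 0) : 0 < minEntry p q w := by
  set S := {v : ℝ | v ≠ 0 ∧ ∃ x : A × B, v = prodDensity p q x ∨
    v = suppRestrict (prodDensity p q) (prodDensity p w) x}
  have hfin : S.Finite := by
    refine ((Set.finite_range (prodDensity p q)).union
      (Set.finite_range (suppRestrict (prodDensity p q) (prodDensity p w)))).subset ?_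
    rintro v ⟨-, y, rfl | rfl⟩
    · exact Or.inl ⟨y, rfl⟩
    · exact Or.inr ⟨y, rfl⟩
  have hmem : sInf S ∈ S := Set.Nonempty.csInf_mem ⟨_, hx, x, Or.inl rfl⟩ hfin
  obtain ⟨hne, y, hy⟩ := hmem
  refine lt_of_le_of_ne ?_ (Ne.symm hne)
  change 0 ≤ sInf S
  rcases hy with hy | hy
  · rw [hy]
    exact mul_nonneg (hp _) (hq _)
  · rw [hy]
    exact Set.indicator_nonneg (fun z _ => mul_nonneg (hp _) (hw _)) y

lemma minEntry_le {p : A → ℝ} {q w : B → ℝ} (hp : ∀ a, 0 ≤ p a) (hq : ∀ b, 0 ≤ q b)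
    (hw : ∀ b, 0 ≤ w b) {x : A × B} (hx : prodDensity p q x ≠ 0) :
    minEntry p q w ≤ prodDensity p q x := by
  refine csInf_le ⟨0, ?_⟩ ⟨hx, x, Or.inl rfl⟩
  rintro v ⟨-, y, rfl | rfl⟩
  · exact mul_nonneg (hp _) (hq _)
  · exact Set.indicator_nonneg (fun z _ => mul_nonneg (hp _) (hw _)) y

/-- The set of admissible constants is nonempty and bounded below by `w b / q b`, so that its
infimum is not a junk value. -/
lemma le_orderConst_mul {q w : B → ℝ} (hq : ∀ b, 0 ≤ q b) {b : B} (hb : 0 < q b) :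
    w b ≤ orderConst q w * q b := by
  have hbound : ∀ x, 0 < q x → ∀ γ ∈ {γ : ℝ | suppRestrict q w ≤ γ • q}, w x / q x ≤ γ := by
    intro x hx γ hγ
    have h1 := hγ x
    rw [suppRestrict, Set.indicator_of_mem (Function.mem_support.2 hx.ne'), Pi.smul_apply,
      smul_eq_mul] at h1
    exact (div_le_iff₀ hx).2 h1
  rw [← div_le_iff₀ hb]
  refine le_csInf ⟨∑ x, |w x / q x|, fun x => ?_⟩ (hbound b hb)
  rw [suppRestrict, Pi.smul_apply, smul_eq_mul]
  rcases (hq x).eq_or_lt with h0 | h0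
  · rw [Set.indicator_of_notMem (by simp [← h0]), ← h0, mul_zero]
  · rw [Set.indicator_of_mem (Function.mem_support.2 h0.ne'), ← div_le_iff₀ h0]
    exact (le_abs_self _).trans (Finset.single_le_sum (f := fun x => |w x / q x|)
      (fun y _ => abs_nonneg _) (Finset.mem_univ x))

lemma exists_pos_le_half {ι : Type*} [Fintype ι] {p : ι → ℝ} (hp : ∀ i, 0 ≤ p i)
    (h1 : ∑ i, p i = 1) (hne : ∀ i, p i ≠ 1) : ∃ i, 0 < p i ∧ p i ≤ 1 / 2 := by
  classical
  obtain ⟨i, -, hi⟩ : ∃ i ∈ Finset.univ, p i ≠ 0 :=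
    Finset.exists_ne_zero_of_sum_ne_zero (by rw [h1]; exact one_ne_zero)
  have hi0 : 0 < p i := (hp i).lt_of_ne (Ne.symm hi)
  by_cases hle : p i ≤ 1 / 2
  · exact ⟨i, hi0, hle⟩
  · have h2 := Finset.add_sum_erase Finset.univ p (Finset.mem_univ i)
    rw [h1] at h2
    obtain ⟨j, hj, hj0⟩ : ∃ j ∈ Finset.univ.erase i, p j ≠ 0 := by
      refine Finset.exists_ne_zero_of_sum_ne_zero fun h0 => hne i ?_
      linarith
    refine ⟨j, (hp j).lt_of_ne (Ne.symm hj0), ?_⟩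
    have := Finset.single_le_sum (f := p) (fun k _ => hp k) hj
    push Not at hle
    linarith

lemma eq_zero_of_apply_eq_one {ι : Type*} [Fintype ι] {p : ι → ℝ} (hp : ∀ i, 0 ≤ p i)
    (h1 : ∑ i, p i = 1) {i : ι} (hi : p i = 1) {j : ι} (hj : j ≠ i) : p j = 0 := by
  classical
  have h2 := Finset.add_sum_erase Finset.univ p (Finset.mem_univ i)
  rw [h1, hi] at h2
  exact (Finset.sum_eq_zero_iff_of_nonneg fun k _ => hp k).1 (by linarith : _ = (0 : ℝ)) j
    (Finset.mem_erase.2 ⟨hj, Finset.mem_univ j⟩)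

/-- A positive mutual information needs two states on each side, so that each
marginal has a positive entry of at most `1 / 2`. -/
lemma exists_marg_le_half {r : A × B → ℝ} (hr : r ∈ stdSimplex ℝ (A × B))
    (hI : 0 < mutualInfo r) :
    (∃ a, 0 < margA r a ∧ margA r a ≤ 1 / 2) ∧ (∃ b, 0 < margB r b ∧ margB r b ≤ 1 / 2) := by
  have hA0 : ∀ a, 0 ≤ margA r a := fun a => Finset.sum_nonneg fun b _ => hr.1 _
  have hB0 : ∀ b, 0 ≤ margB r b := fun b => Finset.sum_nonneg fun a _ => hr.1 _
  have hA1 : ∑ a, margA r a = 1 := by rw [sum_margA, hr.2]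
  have hB1 : ∑ b, margB r b = 1 := by rw [sum_margB, hr.2]
  have zero_of_prod : (∀ x, r x = prodDensity (margA r) (margB r) x) → False := by
    intro h
    refine hI.ne' ?_
    rw [mutualInfo, relEntropy]
    exact Finset.sum_eq_zero fun x _ => by rw [← h x, sub_self, mul_zero]
  constructor
  · refine exists_pos_le_half hA0 hA1 fun a ha => zero_of_prod ?_
    have hz : ∀ a' b, a' ≠ a → r (a', b) = 0 := fun a' b ha' =>
      (Finset.sum_eq_zero_iff_of_nonneg fun b _ => hr.1 (a', b)).1
        (eq_zero_of_apply_eq_one hA0 hA1 ha ha') b (Finset.mem_univ b)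
    rintro ⟨a', b⟩
    by_cases haa : a' = a
    · subst haa
      simp only [prodDensity, ha, one_mul, margB]
      exact (Finset.sum_eq_single a' (fun a'' _ h => hz a'' b h) (by simp)).symm
    · simp [prodDensity, hz a' b haa, eq_zero_of_apply_eq_one hA0 hA1 ha haa]
  · refine exists_pos_le_half hB0 hB1 fun b hb => zero_of_prod ?_
    have hz : ∀ a b', b' ≠ b → r (a, b') = 0 := fun a b' hb' =>
      (Finset.sum_eq_zero_iff_of_nonneg fun a _ => hr.1 (a, b')).1
        (eq_zero_of_apply_eq_one hB0 hB1 hb hb') a (Finset.mem_univ a)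
    rintro ⟨a, b'⟩
    by_cases hbb : b' = b
    · subst hbb
      simp only [prodDensity, hb, mul_one, margA]
      exact (Finset.sum_eq_single b' (fun b'' _ h => hz a b'' h) (by simp)).symm
    · simp [prodDensity, hz a b' hbb, eq_zero_of_apply_eq_one hB0 hB1 hb hbb]

end Constants

lemma log_one_add_le_contFun {m ε : ℝ} (hm0 : 0 < m) (hm1 : m ≤ 1) (hε0 : 0 ≤ ε) (hε1 : ε ≤ 1) :
    (1 - ε) * Real.log ((1 - ε) + ε * m⁻¹) ≤ contFun m ε := by
  have h1 : 1 ≤ m⁻¹ := (one_le_inv₀ hm0).2 hm1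
  have h2 : 0 ≤ Real.log (ε + (1 - ε) * m⁻¹) := Real.log_nonneg (by nlinarith)
  have h3 := Real.binEntropy_nonneg hε0 hε1
  have := mul_nonneg hε0 h2
  rw [contFun]
  linarith

/-- The smallness condition on `f_m(ε)` forces the noise to be of order `a m ^ 3`. -/
lemma noise_le_of_contFun_lt {a m ε : ℝ} (ha0 : 0 < a) (ha1 : a < 1) (hm0 : 0 < m)
    (hm : m ≤ 1 / 4) (hε0 : 0 ≤ ε) (hε1 : ε < 1)
    (h : 2 * contFun m ε / (1 - ε) < a * m ^ 2) : ε ≤ a * m ^ 3 := by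
  have h1 : 0 < 1 - ε := by linarith
  have h2 := log_one_add_le_contFun hm0 (by linarith) hε0 hε1.le
  rw [div_lt_iff₀ h1] at h
  have hmi : 4 ≤ m⁻¹ := by
    rw [le_inv_comm₀ (by norm_num) hm0]
    linarith
  set X := (1 - ε) + ε * m⁻¹ with hX
  have hX1 : 1 ≤ X := by nlinarith
  have h3 : 2 * Real.log X < a * m ^ 2 := by
    have : (1 - ε) * (2 * Real.log X) < (1 - ε) * (a * m ^ 2) := by linarith
    exact lt_of_mul_lt_mul_left this h1.le
  have h4 := Real.one_sub_inv_le_log_of_pos (by linarith : 0 < X)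
  have h5 : X - 1 ≤ a * m ^ 2 / 2 * X := by
    have h6 : 1 - X⁻¹ ≤ a * m ^ 2 / 2 := by linarith
    have h7 := mul_le_mul_of_nonneg_right h6 (by linarith : 0 ≤ X)
    have h8 : (1 - X⁻¹) * X = X - 1 := by
      have : X ≠ 0 := by linarith
      field_simp
    linarith
  have hm2 : a * m ^ 2 ≤ 1 / 16 := by nlinarith
  have h9 : X - 1 ≤ 16 / 31 * (a * m ^ 2) := by nlinarith
  have h10 : (X - 1) * m = ε * (1 - m) := by
    rw [hX]
    field_simp
    ring
  have h11 := mul_le_mul_of_nonneg_right h9 hm0.le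
  rw [h10] at h11
  have h12 : ε * (3 / 4) ≤ ε * (1 - m) := mul_le_mul_of_nonneg_left (by linarith) hε0
  have h13 : 0 ≤ a * m ^ 3 := by positivity
  nlinarith

/-- For `e ≤ ε ≤ 1 / 2` the loss at noise `e` is at most `f_m(ε)`; the term
`ε log (ε + (1 - ε) / m)` compensates for the decrease of the factor `1 - e` to `1 - ε`. -/
lemma binEntropy_add_le_contFun {m e ε : ℝ} (hm0 : 0 < m) (hm1 : m ≤ 1) (he0 : 0 ≤ e)
    (heε : e ≤ ε) (hε : ε ≤ 1 / 2) :
    Real.binEntropy e + (1 - e) * Real.log ((1 - e) + e * m⁻¹) ≤ contFun m ε := by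
  have h1 : 1 ≤ m⁻¹ := (one_le_inv₀ hm0).2 hm1
  have h2 : Real.binEntropy e ≤ Real.binEntropy ε := by
    refine Real.binEntropy_strictMonoOn.monotoneOn ⟨he0, ?_⟩ ⟨by linarith, ?_⟩ heε <;>
    · norm_num
      linarith
  have h3 : Real.log ((1 - e) + e * m⁻¹) ≤ Real.log ((1 - ε) + ε * m⁻¹) :=
    Real.log_le_log (by nlinarith) (by nlinarith)
  have h4 : Real.log ((1 - ε) + ε * m⁻¹) ≤ Real.log (ε + (1 - ε) * m⁻¹) :=
    Real.log_le_log (by nlinarith) (by nlinarith)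
  have h5 : 0 ≤ Real.log ((1 - ε) + ε * m⁻¹) := Real.log_nonneg (by nlinarith)
  have h6 := mul_le_mul_of_nonneg_left h3 (by linarith : 0 ≤ 1 - e)
  have h7 := mul_le_mul_of_nonneg_left h4 (by linarith : 0 ≤ ε)
  have h8 := mul_nonneg he0 h5
  rw [contFun]
  linarith

/-- The jump probability `1 - exp (-x)` against the noise `1 - exp (-c x)`. -/
lemma mul_one_sub_exp_le (c x : ℝ) :
    c * x ≤ (1 - Real.exp (-(c * x))) / (1 - (1 - Real.exp (-(c * x)))) := by
  have h0 := Real.exp_pos (-(c * x))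
  rw [sub_sub_cancel, le_div_iff₀ h0]
  have h1 := Real.add_one_le_exp (c * x)
  have h2 : Real.exp (c * x) * Real.exp (-(c * x)) = 1 := by
    rw [← Real.exp_add]
    simp
  nlinarith

/-! ### The two regimes -/

section Regimes

variable {A B : Type*} [Fintype A] [DecidableEq A] [Fintype B] [DecidableEq B]

/-- The regime of small mutual information: along the segment from the product density to the
density every slice stays close to the product, so that the second derivative of the relative
entropy contracts by at most the stated factor. -/
lemma mul_mutualInfo_le_of_le {T E P : Matrix B B ℝ} {c e a m g ε : ℝ}
    (hE : IsMovingPart E P c e) (hT : T = (1 - e) • (1 : Matrix B B ℝ) + P) (he1 : e ≤ 1)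
    (ha0 : 0 < a) (ha1 : a < 1) (hm0 : 0 < m) (hm : m ≤ 1 / 4) (hε0 : 0 ≤ ε)
    (hε : ε ≤ a * m ^ 3) (hce : c * e ≤ ε / (1 - ε)) {ρ : A × B → ℝ}
    (hρ : ρ ∈ stdSimplex ℝ (A × B)) {ω : B → ℝ}
    (hρE : actB E ρ = prodDensity (margA ρ) ω)
    (hωg : ∀ b, 0 < margB ρ b → ω b ≤ g * margB ρ b)
    (hmσ : ∀ x, prodDensity (margA ρ) (margB ρ) x ≠ 0 → m ≤ prodDensity (margA ρ) (margB ρ) x)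
    (hmB : ∀ b, 0 < margB ρ b → 2 * m ≤ margB ρ b)
    (hI : mutualInfo ρ ≤ a * m ^ 2 / 2) :
    (1 - ε) ^ 2 / ((1 - ε) + ε * (g / (1 - a))) * mutualInfo ρ ≤ mutualInfo (actB T ρ) := by
  set pA := margA ρ
  set pB := margB ρ
  set σ : A × B → ℝ := prodDensity pA pB with hσ
  set δ : A × B → ℝ := fun x => ρ x - σ x with hδ
  have hA0 : ∀ a, 0 ≤ pA a := fun a => Finset.sum_nonneg fun b _ => hρ.1 _
  have hB0 : ∀ b, 0 ≤ pB b := fun b => Finset.sum_nonneg fun a _ => hρ.1 _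
  have hA1 : ∑ a, pA a = 1 := by rw [sum_margA, hρ.2]
  have hB1 : ∑ b, pB b = 1 := by rw [sum_margB, hρ.2]
  have hσ0 : ∀ x, 0 ≤ σ x := fun x => mul_nonneg (hA0 _) (hB0 _)
  have hσ1 : ∑ x, σ x = 1 := by rw [hσ, sum_prodDensity, hA1, hB1, one_mul]
  have hsupp : ∀ x, σ x = 0 → ρ x = 0 := fun x => prodDensity_marg_eq_zero hρ.1
  have hδsupp : ∀ x, σ x = 0 → δ x = 0 := fun x hx => by simp [hδ, hsupp x hx, hx]
  have hTcol : ∀ j, ∑ i, T i j = 1 := fun j => by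
    simp [hT, Finset.sum_add_distrib, hE.sum_col, Matrix.one_apply]
  have hTapply : ∀ v : B → ℝ, ∀ b, (T *ᵥ v) b = (1 - e) * v b + (P *ᵥ v) b := by
    intro v b
    simp [hT, Matrix.add_mulVec, Matrix.smul_mulVec]
  -- the fixed point projection sends the slices of `σ` and `ρ` to the same vector
  have hEω : E *ᵥ pB = ω := by
    rw [← margB_actB, hρE]
    funext b
    simp only [margB, prodDensity]
    rw [← Finset.sum_mul, hA1, one_mul]
  have hEσ : ∀ a b, (E *ᵥ fun x => σ (a, x)) b = pA a * ω b := by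
    intro a b
    rw [← actB_apply, hσ, actB_prodDensity, hEω]
    rfl
  have hEρ : ∀ a b, (E *ᵥ fun x => ρ (a, x)) b = pA a * ω b := by
    intro a b
    rw [← actB_apply, hρE]
    rfl
  have hclsσ : ∀ a b, E b b * ∑ x ∈ ergodicClass E b, σ (a, x) = pA a * ω b := fun a b => by
    rw [← hE.proj_mulVec (fun x => σ (a, x)), hEσ]
  have hclsρ : ∀ a b, ∑ x ∈ ergodicClass E b, ρ (a, x) = ∑ x ∈ ergodicClass E b, σ (a, x) :=
    fun a b => by
      refine mul_left_cancel₀ (hE.proj_self_pos b).ne' ?_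
      rw [hclsσ, ← hE.proj_mulVec (fun x => ρ (a, x)), hEρ]
  have hslice : ∀ u ∈ Set.Icc (0 : ℝ) 1, ∀ a', IsNearSlice E c a m g (fun b => σ (a', b))
      (fun b => σ (a', b) + u * δ (a', b)) := by
    intro u hu a'
    refine ⟨fun b => hσ0 _, fun b hb => ?_, fun b => ?_, fun b hb => ?_, fun b hb => ?_,
      fun b hb => hmσ _ hb.ne', fun b hb => ?_⟩
    · simp only [hb, hδsupp _ hb, mul_zero, add_zero]
    · simp only [hδ]
      rw [Finset.sum_add_distrib, ← Finset.mul_sum, Finset.sum_sub_distrib, hclsρ, sub_self,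
        mul_zero, add_zero]
    · have hpB : 0 < pB b := (hB0 b).lt_of_ne fun h => by
        simp [hσ, prodDensity, ← h] at hb
      have hM0 : 0 ≤ ∑ x ∈ ergodicClass E b, σ (a', x) := Finset.sum_nonneg fun x _ => hσ0 _
      have hc0 : 0 ≤ c := zero_le_one.trans (hE.one_le_const b)
      calc ∑ x ∈ ergodicClass E b, σ (a', x)
          ≤ (c * E b b) * ∑ x ∈ ergodicClass E b, σ (a', x) :=
            le_mul_of_one_le_left hM0 (hE.one_le b)
        _ = c * (pA a' * ω b) := by rw [mul_assoc, hclsσ]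
        _ ≤ c * (pA a' * (g * pB b)) := by
            gcongr
            · exact hA0 a'
            · exact hωg b hpB
        _ = c * g * σ (a', b) := by
            simp only [hσ, prodDensity]
            ring
    · have hlt : u * δ (a', b) < 0 := by linarith
      have hδneg : δ (a', b) < 0 := by
        by_contra hcon
        push Not at hcon
        linarith [mul_nonneg hu.1 hcon]
      have hρσ : ρ (a', b) ≤ σ (a', b) := by
        simp only [hδ] at hδneg
        linarith
      have h1 := sq_le_two_mul_mul_relEntropy (p := ρ) (q := σ) (by rw [hρ.2, hσ1]) hρ.1 hσ0
        hsupp hρσ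
      have h2 : relEntropy ρ σ ≤ a * m ^ 2 / 2 := hI
      have h3 := mul_le_mul_of_nonneg_left h2 (mul_nonneg zero_le_two (hσ0 (a', b)))
      have hu2 : u ^ 2 ≤ 1 := by nlinarith [hu.1, hu.2]
      calc (σ (a', b) - (σ (a', b) + u * δ (a', b))) ^ 2 = u ^ 2 * (σ (a', b) - ρ (a', b)) ^ 2 := by
            simp only [hδ]
            ring
        _ ≤ 1 * (σ (a', b) - ρ (a', b)) ^ 2 := by gcongr
        _ ≤ a * m ^ 2 * σ (a', b) := by linarith
    · have hpB : 0 < pB b := (hB0 b).lt_of_ne fun h => by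
        simp [hσ, prodDensity, ← h] at hb
      have hM : ∑ x ∈ ergodicClass E b, σ (a', x) ≤ pA a' := by
        calc ∑ x ∈ ergodicClass E b, σ (a', x) ≤ ∑ x, σ (a', x) :=
              Finset.sum_le_sum_of_subset_of_nonneg (Finset.subset_univ _) fun x _ _ => hσ0 _
          _ = pA a' := by
              simp only [hσ, prodDensity]
              rw [← Finset.mul_sum, hB1, mul_one]
      calc 2 * m * ∑ x ∈ ergodicClass E b, σ (a', x) ≤ pB b * pA a' := by
            refine mul_le_mul (hmB b hpB) hM (Finset.sum_nonneg fun x _ => hσ0 _) hpB.le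
        _ = σ (a', b) := mul_comm _ _
  have hTnn : ∀ i j, 0 ≤ T i j := fun i j => by
    rw [hT, Matrix.add_apply, Matrix.smul_apply, smul_eq_mul, Matrix.one_apply]
    have := hE.nonneg i j
    split_ifs <;> linarith
  have hhalf : ∀ u ∈ Set.Icc (0 : ℝ) 1, ∀ x, σ x / 2 ≤ σ x + u * δ x := fun u hu x =>
    (hslice u hu x.1).half_le ha1 hm0 hm x.2
  have hactpos : ∀ v : A × B → ℝ, (∀ x, 0 ≤ v x) → ∀ x, 0 ≤ actB T v x := by
    rintro v hv ⟨a', b⟩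
    rw [actB_apply]
    exact Finset.sum_nonneg fun x _ => mul_nonneg (hTnn _ _) (hv _)
  have hact_add : ∀ (v v' : A × B → ℝ) (u : ℝ) (x : A × B),
      actB T v x + u * actB T v' x = actB T (fun y => v y + u * v' y) x := by
    rintro v v' u ⟨a', b⟩
    simp only [actB_apply, Matrix.mulVec, dotProduct, Finset.mul_sum]
    rw [← Finset.sum_add_distrib]
    exact Finset.sum_congr rfl fun x _ => by ring
  have hact_half : ∀ u ∈ Set.Icc (0 : ℝ) 1, ∀ x,
      actB T σ x / 2 ≤ actB T σ x + u * actB T δ x := by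
    intro u hu x
    have h1 := hactpos (fun y => σ y / 2 + u * δ y)
      (fun y => by have := hhalf u hu y; linarith) x
    have h2 := hact_add (fun y => σ y / 2) δ u x
    have h3 : actB T (fun y => σ y / 2) x = actB T σ x / 2 := by
      obtain ⟨a', b⟩ := x
      simp only [actB_apply, Matrix.mulVec, dotProduct, Finset.sum_div]
      exact Finset.sum_congr rfl fun x _ => by ring
    linarith
  have hσ'0 := hactpos σ hσ0
  have hδ'supp : ∀ x, actB T σ x = 0 → actB T δ x = 0 := by
    rintro ⟨a', b⟩ h
    rw [actB_apply] at h ⊢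
    have h1 := (Finset.sum_eq_zero_iff_of_nonneg
      (fun x _ => mul_nonneg (hTnn b x) (hσ0 (a', x)))).1 h
    refine Finset.sum_eq_zero fun x hx => ?_
    change T b x * δ (a', x) = 0
    rcases mul_eq_zero.1 (h1 x hx) with h2 | h2
    · rw [h2, zero_mul]
    · rw [hδsupp _ h2, mul_zero]
  have hsumδ : ∑ x, δ x = 0 := by
    simp only [hδ]
    rw [Finset.sum_sub_distrib, hρ.2, hσ1, sub_self]
  have hsumδ' : ∑ x, actB T δ x = 0 := by
    rw [← sum_margA, margA_actB hTcol, sum_margA, hsumδ]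
  have key := mul_relEntropy_le_of_forall (q := σ) (d := δ) (q' := actB T σ) (d' := actB T δ)
    (F := (1 - ε) ^ 2 / ((1 - ε) + ε * (g / (1 - a)))) hδsupp hδ'supp hsumδ hsumδ'
    (fun u hu x hx => by
      have h1 : 0 < σ x := (hσ0 x).lt_of_ne (Ne.symm hx)
      linarith [hhalf u hu x])
    (fun u hu x hx => by
      have h1 : 0 < actB T σ x := (hσ'0 x).lt_of_ne (Ne.symm hx)
      linarith [hact_half u hu x])
    (fun u hu => by
      rw [Fintype.sum_prod_type, Fintype.sum_prod_type, Finset.mul_sum]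
      refine Finset.sum_le_sum fun a' _ => ?_
      have hs := hslice u hu a'
      have h1 := sum_sq_div_sub_le (w := fun b => σ (a', b) + u * δ (a', b))
        (d := fun b => δ (a', b)) he1 hE.nonneg hE.sum_col (hs.nonneg' ha1 hm0 hm) (fun b hb => by
          refine hδsupp _ ?_
          have := hhalf u hu (a', b)
          linarith [hσ0 (a', b)])
      have h2 : ∀ b, actB T σ (a', b) + u * actB T δ (a', b)
          = (1 - e) * (σ (a', b) + u * δ (a', b))
            + (P *ᵥ fun b => σ (a', b) + u * δ (a', b)) b := fun b => by
        rw [hact_add, actB_apply, hTapply]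
      simp only [h2]
      simp only [actB_apply, hTapply]
      refine le_trans ?_ h1
      rw [Finset.mul_sum]
      refine Finset.sum_le_sum fun b _ => ?_
      rcases (hσ0 (a', b)).eq_or_lt with h0 | h0
      · simp [hδsupp _ h0.symm]
      · have h3 := hs.lossCoef_le hE ha0 ha1 hm0 hm hε0 hε hce h0
        have h4 : 0 ≤ δ (a', b) ^ 2 / (σ (a', b) + u * δ (a', b)) := by
          have := hhalf u hu (a', b)
          exact div_nonneg (sq_nonneg _) (by linarith)
        exact mul_le_mul_of_nonneg_right (by linarith) h4)
  have e1 : (fun x => σ x + δ x) = ρ := by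
    funext x
    simp [hδ]
  have e2 : (fun x => actB T σ x + actB T δ x) = actB T ρ := by
    funext x
    have := hact_add σ δ 1 x
    rw [one_mul] at this
    rw [this]
    congr 1
    funext y
    simp [hδ]
  rw [e1, e2] at key
  rw [mutualInfo_actB hTcol]
  exact key

end Regimes

end ClassicalDecay

/-! ### Decay of the mutual information -/

open ClassicalDecay in
theorem mainTheorem3 {A B : Type*} [Fintype A] [DecidableEq A] [Fintype B] [DecidableEq B]
    (L E : Matrix B B ℝ) (hL : IsLindbladian L) (hE : IsFixedPointProjection L E)
    (c : ℝ) (hc : CPLe 1 (c • E))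
    (pA : A → ℝ) (pB ω : B → ℝ) (hω : ω ∈ stdSimplex ℝ B)
    (t : ℝ) (ht : 0 ≤ t) (a : ℝ) (ha0 : 0 < a) (ha1 : a < 1)
    (ha : 2 * contFun (minEntry pA pB ω) (noise L c t) / (1 - noise L c t)
      < a * minEntry pA pB ω ^ 2)
    (ρ : A × B → ℝ) (hρ : ρ ∈ stdSimplex ℝ (A × B)) (hρA : margA ρ = pA) (hρB : margB ρ = pB)
    (hρE : actB E ρ = prodDensity pA ω) :
    (a * minEntry pA pB ω ^ 2 / 2 ≤ mutualInfo ρ →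
      (1 - noise L c t
          - 2 * contFun (minEntry pA pB ω) (noise L c t) / (a * minEntry pA pB ω ^ 2))
        * mutualInfo ρ ≤ mutualInfo (actB (semigroup L t) ρ)) ∧
    (mutualInfo ρ ≤ a * minEntry pA pB ω ^ 2 / 2 →
      ((1 - a) * (1 - noise L c t) ^ 2
          / ((1 - noise L c t) * (1 - a) + noise L c t * orderConst pB ω))
        * mutualInfo ρ ≤ mutualInfo (actB (semigroup L t) ρ)) := by
  subst hρA hρB
  set m := minEntry (margA ρ) (margB ρ) ω
  set ε := noise L c t with hεdef
  -- `e` is the jump probability, `P` the moving part of the semigroup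
  set x := t * (diamondNorm L / 2)
  set e := 1 - Real.exp (-x) with hedef
  set P := semigroup L t - Real.exp (-x) • (1 : Matrix B B ℝ) with hP
  have hmov : IsMovingPart E P c e := isMovingPart_semigroup hL hE hc ht
  have hT : semigroup L t = (1 - e) • (1 : Matrix B B ℝ) + P := by
    rw [hP, hedef, sub_sub_cancel, add_sub_cancel]
  have hx0 : 0 ≤ x := mul_nonneg ht (by linarith [diamondNorm_nonneg L])
  obtain ⟨b₀, -, -⟩ : ∃ b ∈ Finset.univ, ω b ≠ 0 :=
    Finset.exists_ne_zero_of_sum_ne_zero (by rw [hω.2]; exact one_ne_zero)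
  have hc1 : 1 ≤ c := hmov.one_le_const b₀
  have hεx : ε = 1 - Real.exp (-(c * x)) := by
    rw [hεdef, noise]
    congr 3
    simp only [x]
    ring
  have hcx : x ≤ c * x := le_mul_of_one_le_left hx0 hc1
  have hε1 : ε < 1 := by
    rw [hεx]
    linarith [Real.exp_pos (-(c * x))]
  have he0 : 0 ≤ e := hmov.weight_nonneg b₀
  have he1 : e < 1 := by linarith [Real.exp_pos (-x)]
  have heε : e ≤ ε := by
    rw [hεx, hedef]
    linarith [Real.exp_le_exp.2 (neg_le_neg hcx)]
  have hε0 : 0 ≤ ε := he0.trans heε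
  have hce : c * e ≤ ε / (1 - ε) := by
    rw [hεx]
    refine le_trans (mul_le_mul_of_nonneg_left ?_ (by linarith)) (mul_one_sub_exp_le c x)
    linarith [Real.add_one_le_exp (-x)]
  have hA0 : ∀ a, 0 ≤ margA ρ a := fun a => Finset.sum_nonneg fun b _ => hρ.1 _
  have hB0 : ∀ b, 0 ≤ margB ρ b := fun b => Finset.sum_nonneg fun a _ => hρ.1 _
  have hmle : ∀ y, prodDensity (margA ρ) (margB ρ) y ≠ 0 →
      m ≤ prodDensity (margA ρ) (margB ρ) y := fun y hy => minEntry_le hA0 hB0 hω.1 hy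
  have hm0 : 0 < m := by
    obtain ⟨y, -, hy⟩ : ∃ y ∈ Finset.univ, ρ y ≠ 0 :=
      Finset.exists_ne_zero_of_sum_ne_zero (by rw [hρ.2]; exact one_ne_zero)
    exact minEntry_pos hA0 hB0 hω.1 fun h => hy (prodDensity_marg_eq_zero hρ.1 h)
  have ham : 0 < a * m ^ 2 := by positivity
  have hposI : 0 < mutualInfo ρ → m ≤ 1 / 4 ∧ (∀ b, 0 < margB ρ b → 2 * m ≤ margB ρ b) := by
    intro hI
    obtain ⟨⟨i, hi0, hi⟩, j, hj0, hj⟩ := exists_marg_le_half hρ hI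
    have hb : ∀ b, 0 < margB ρ b → 2 * m ≤ margB ρ b := by
      intro b hb
      have h1 : m ≤ margA ρ i * margB ρ b := hmle (i, b) (mul_pos hi0 hb).ne'
      nlinarith
    exact ⟨by linarith [hb j hj0], hb⟩
  constructor
  · intro hI
    obtain ⟨hm, -⟩ := hposI (by linarith)
    have hε := noise_le_of_contFun_lt ha0 ha1 hm0 hm hε0 hε1 ha
    have hε2 : ε ≤ 1 / 2 := by
      obtain ⟨-, -, h⟩ := noise_mul_le (Y := 0) ha0 hm0 hm hε le_rfl (by simp)
      linarith
    have h1 := mul_mutualInfo_sub_le he1 he0 hmov.nonneg hmov.sum_col hT hm0 hρ hmle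
    have h2 := binEntropy_add_le_contFun hm0 (by linarith) he0 heε hε2
    have h3 : 0 ≤ contFun m ε := le_trans (mul_nonneg (by linarith) (Real.log_nonneg (by
      have := (one_le_inv₀ hm0).2 (by linarith : m ≤ 1)
      nlinarith))) (log_one_add_le_contFun hm0 (by linarith) hε0 hε1.le)
    have h4 : contFun m ε ≤ 2 * contFun m ε / (a * m ^ 2) * mutualInfo ρ := by
      rw [div_mul_eq_mul_div, le_div_iff₀ ham]
      nlinarith
    have h5 : (1 - ε) * mutualInfo ρ ≤ (1 - e) * mutualInfo ρ :=
      mul_le_mul_of_nonneg_right (by linarith) (by linarith)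
    linarith
  · intro hI
    rcases (mutualInfo_nonneg hρ).eq_or_lt with h0 | h0
    · rw [← h0, mul_zero]
      exact mutualInfo_nonneg (actB_mem_stdSimplex (hL t ht) hρ)
    · obtain ⟨hm, hmB⟩ := hposI h0
      have hε := noise_le_of_contFun_lt ha0 ha1 hm0 hm hε0 hε1 ha
      have key := mul_mutualInfo_le_of_le hmov hT he1.le ha0 ha1 hm0 hm hε0 hε hce hρ hρE
        (fun b hb => le_orderConst_mul hB0 hb) hmle hmB hI
      have h1 : 1 - a ≠ 0 := by linarith
      rwa [show (1 - ε) + ε * (orderConst (margB ρ) ω / (1 - a))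
        = ((1 - ε) * (1 - a) + ε * orderConst (margB ρ) ω) / (1 - a) by field_simp,
        div_div_eq_mul_div, mul_comm ((1 - ε) ^ 2)] at key
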